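/- Let $\mathfrak g=\mathfrak{sl}(2,\mathbb R)$ with standard basis $H=\begin{pmatrix}1&0\\0&-1\end{pmatrix}$, $X=\begin{pmatrix}0&1\\0&0\end{pmatrix}$, $Y=\begin{pmatrix}0&0\\1&0\end{pmatrix}$, and let $\mathcal N\subset\mathfrak g$ be its nilpotent cone, i.e. the set of nilpotent matrices in $\mathfrak g$. Let $\rho:\mathfrak g\to\operatorname{End}(V)$ be a representation of $\mathfrak g$ in a finite dimensional real vector space $V$, and let $\mathcal U\subset\mathfrak g$ be an open subset that is $SL(2,\mathbb R)$-invariant, i.e. $gZg^{-1}\in\mathcal U$ for all $g\in SL(2,\mathbb R)$ and $Z\in\mathcal U$. Let $\mathcal C^{-\infty}(\mathcal U,V)$ be the space of $V$-valued generalized functions on $\mathcal U$, i.e. of continuous linear maps from the compactly supported smooth densities on $\mathcal U$ to $V$; by the choice of a Lebesgue measure on $\mathfrak g$ these are the $V$-valued distributions on $\mathcal U$. For $Z\in\mathfrak g$ let $\partial_Z$ be the derivative in the direction $Z$, let $\mathcal L_Z$ be the differential operator $(\mathcal L_Z\phi)(W)=\frac{d}{dt}\phi(W-t[Z,W])\big|_{t=0}$,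 and let $\square=\frac12\partial_H^2+2\,\partial_Y\partial_X$ be the Casimir operator, all acting on $\mathcal C^{-\infty}(\mathcal U,V)$. Let $\phi\in\mathcal C^{-\infty}(\mathcal U,V)$ be such that 1. $\phi$ is locally invariant, i.e. $(\rho(Z)+\mathcal L_Z)\phi=0$ for every $Z\in\mathfrak g$; 2. $\phi|_{\mathcal U\setminus\mathcal N}=0$; 3. $\phi$ is $\square$-finite, i.e. $\dim_{\mathbb R}(\mathbb R[\square]\phi)<\infty$. Then $\phi=0$. -/

import Mathlib

open scoped Distributions LineDeriv

noncomputable section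

namespace SL2

/-- The real Lie algebra `sl(2, ℝ)` of real `2 × 2` matrices of trace zero. It is a type synonym of
Mathlib's `sl`, with the same Lie algebra structure; its topology comes from the norm below. -/
def Alg : Type := LieAlgebra.SpecialLinear.sl (Fin 2) ℝ

instance instLieRingAlg : LieRing Alg :=
  inferInstanceAs (LieRing (LieAlgebra.SpecialLinear.sl (Fin 2) ℝ))

instance instLieAlgebraAlg : LieAlgebra ℝ Alg :=
  inferInstanceAs (LieAlgebra ℝ (LieAlgebra.SpecialLinear.sl (Fin 2) ℝ))

/-- The underlying matrix of an element of `sl(2, ℝ)`, as a linear map. -/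
def toMatrix : Alg →ₗ[ℝ] Matrix (Fin 2) (Fin 2) ℝ where
  toFun Z := Z.val
  map_add' _ _ := rfl
  map_smul' _ _ := rfl

theorem toMatrix_injective : Function.Injective toMatrix := Subtype.coe_injective

theorem toMatrix_lie (Z W : Alg) :
    toMatrix ⁅Z, W⁆ = toMatrix Z * toMatrix W - toMatrix W * toMatrix Z := rfl

theorem trace_toMatrix (Z : Alg) : (toMatrix Z).trace = 0 := Z.property

/-- The element of `sl(2, ℝ)` given by a matrix of trace zero. -/
def ofMatrix (A : Matrix (Fin 2) (Fin 2) ℝ) (hA : A.trace = 0) : Alg := ⟨A, hA⟩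

@[simp]
theorem toMatrix_ofMatrix (A : Matrix (Fin 2) (Fin 2) ℝ) (hA : A.trace = 0) :
    toMatrix (ofMatrix A hA) = A := rfl

instance instFiniteDimensionalAlg : FiniteDimensional ℝ Alg :=
  FiniteDimensional.of_injective toMatrix toMatrix_injective

section Norm

attribute [local instance] Matrix.normedAddCommGroup Matrix.normedSpace

/-- The norm on `sl(2, ℝ)` is the maximum of the absolute values of the matrix entries. Only the
topology and the smooth structure that it defines matter, and in finite dimension they do not depend
on the choice of the norm. -/
instance instNormedAddCommGroupAlg : NormedAddCommGroup Alg :=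
  NormedAddCommGroup.induced Alg (Matrix (Fin 2) (Fin 2) ℝ) toMatrix toMatrix_injective

instance instNormedSpaceAlg : NormedSpace ℝ Alg :=
  NormedSpace.induced ℝ Alg (Matrix (Fin 2) (Fin 2) ℝ) toMatrix

end Norm

/-- The standard basis element `H`. -/
def H : Alg := ofMatrix !![1, 0; 0, -1] (by simp [Matrix.trace_fin_two])

/-- The standard basis element `X`. -/
def X : Alg := ofMatrix !![0, 1; 0, 0] (by simp [Matrix.trace_fin_two])

/-- The standard basis element `Y`. -/
def Y : Alg := ofMatrix !![0, 0; 1, 0] (by simp [Matrix.trace_fin_two])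

/-- The nilpotent cone of `sl(2, ℝ)`. -/
def nilpotentCone : Set Alg := {Z | IsNilpotent (toMatrix Z)}

/-- The adjoint action of `SL(2, ℝ)` on `sl(2, ℝ)`: `Ad g Z = g Z g⁻¹`. -/
def Ad (g : Matrix.SpecialLinearGroup (Fin 2) ℝ) (Z : Alg) : Alg :=
  ofMatrix ((g : Matrix (Fin 2) (Fin 2) ℝ) * toMatrix Z *
      ((g⁻¹ : Matrix.SpecialLinearGroup (Fin 2) ℝ) : Matrix (Fin 2) (Fin 2) ℝ)) (by
    rw [Matrix.trace_mul_comm, ← mul_assoc, ← Matrix.SpecialLinearGroup.coe_mul, inv_mul_cancel,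
      Matrix.SpecialLinearGroup.coe_one, one_mul, trace_toMatrix])

/-- A subset of `sl(2, ℝ)` is `SL(2, ℝ)`-invariant if it is stable under the adjoint action. -/
def IsInvariantSet (s : Set Alg) : Prop :=
  ∀ g : Matrix.SpecialLinearGroup (Fin 2) ℝ, ∀ Z ∈ s, Ad g Z ∈ s

/-- The bracket `W ↦ -⁅Z, W⁆` as a continuous linear map. -/
def negAd (Z : Alg) : Alg →L[ℝ] Alg :=
  LinearMap.toContinuousLinearMap (-(LieAlgebra.ad ℝ Alg Z : Alg →ₗ[ℝ] Alg))

variable {U : TopologicalSpace.Opens Alg}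

/-- The first order differential operator `ℒ_Z` on test functions,
`(ℒ_Z f)(W) = d/dt f(W - t ⁅Z, W⁆)` at `t = 0`; see `lieDerivTest_apply`. -/
def lieDerivTest (Z : Alg) : 𝓓(U, ℝ) →L[ℝ] 𝓓(U, ℝ) :=
  TestFunction.limitCLM ℝ
    (fun f =>
      { toFun := fun W => fderiv ℝ f W (negAd Z W)
        contDiff' := (f.contDiff.fderiv_right (m := ((⊤ : ℕ∞) : WithTop ℕ∞)) le_rfl).clm_apply
          (negAd Z).contDiff
        hasCompactSupport' := (f.hasCompactSupport.fderiv ℝ).mono fun W hW h0 => hW (by simp [h0])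
        tsupport_subset' := by
          have h : Function.support (fun W => fderiv ℝ f W (negAd Z W)) ⊆
              Function.support (fderiv ℝ f) := fun W hW h0 => hW (by simp [h0])
          exact (closure_mono h).trans ((tsupport_fderiv_subset ℝ).trans f.tsupport_subset) })
    (fun _ hK => TestFunction.ofSupportedInCLM ℝ hK ∘L
      ContDiffMapSupportedIn.bilinLeftCLM (ContinuousLinearMap.id ℝ (Alg →L[ℝ] ℝ))
        (g := negAd Z) (negAd Z).contDiff ∘L
      ContDiffMapSupportedIn.fderivCLM ℝ ⊤ ⊤)
    (fun K hK f => by ext W; simp)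

theorem lieDerivTest_apply (Z : Alg) (f : 𝓓(U, ℝ)) (W : Alg) :
    lieDerivTest Z f W = deriv (fun t : ℝ => f (W - t • ⁅Z, W⁆)) 0 := by
  have h1 : lieDerivTest Z f W = fderiv ℝ f W (-⁅Z, W⁆) := rfl
  have hf : DifferentiableAt ℝ f W := (f.contDiff.differentiable (by simp)).differentiableAt
  rw [h1, ← hf.lineDeriv_eq_fderiv, lineDeriv]
  congr 1
  ext t
  rw [smul_neg, sub_eq_add_neg]

variable {V : Type*} [NormedAddCommGroup V] [NormedSpace ℝ V]

/-- The operator `ℒ_Z` on `V`-valued generalized functions, obtained by duality. As `sl(2, ℝ)` is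
unimodular (`tr (ad Z) = 0`), the vector field `W ↦ -⁅Z, W⁆` is divergence free, so the formal
transpose of `ℒ_Z` with respect to Lebesgue measure is `-ℒ_Z`. -/
def lieDeriv (Z : Alg) (φ : 𝓓'(U, V)) : 𝓓'(U, V) :=
  -(lieDerivTest Z).precompCompactConvergenceCLM V φ

theorem lieDeriv_apply (Z : Alg) (φ : 𝓓'(U, V)) (f : 𝓓(U, ℝ)) :
    lieDeriv Z φ f = -φ (lieDerivTest Z f) := rfl

/-- The Casimir operator `□ = ½ ∂_H² + 2 ∂_Y ∂_X` on `V`-valued generalized functions. -/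
def casimir : 𝓓'(U, V) →ₗ[ℝ] 𝓓'(U, V) where
  toFun φ := (1 / 2 : ℝ) • ∂_{H} (∂_{H} φ) + (2 : ℝ) • ∂_{Y} (∂_{X} φ)
  map_add' φ ψ := by
    simp only [LineDeriv.lineDerivOp_add, smul_add]
    abel
  map_smul' c φ := by
    simp only [LineDeriv.lineDerivOp_smul, smul_add, RingHom.id_apply, smul_comm c]

theorem casimir_apply (φ : 𝓓'(U, V)) (f : 𝓓(U, ℝ)) :
    casimir φ f = (1 / 2 : ℝ) • φ (∂_{H} (∂_{H} f)) + (2 : ℝ) • φ (∂_{X} (∂_{Y} f)) := by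
  change (1 / 2 : ℝ) • (∂_{H} (∂_{H} φ)) f + (2 : ℝ) • (∂_{Y} (∂_{X} φ)) f = _
  simp [LineDeriv.lineDerivOp_neg]

/-- `φ` is `□`-finite if `ℝ[□] φ`, the span of the `□ᵏ φ`, is finite dimensional. -/
def IsCasimirFinite (φ : 𝓓'(U, V)) : Prop :=
  FiniteDimensional ℝ (Submodule.span ℝ (Set.range fun k : ℕ => (casimir ^ k) φ))

variable [FiniteDimensional ℝ V] [LieRingModule Alg V] [LieModule ℝ Alg V]

/-- The action of `sl(2, ℝ)` on `V`-valued generalized functions, `Z • φ = ρ(Z) φ + ℒ_Z φ`. -/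
def lieAction (Z : Alg) (φ : 𝓓'(U, V)) : 𝓓'(U, V) :=
  Distribution.mapCLM (LinearMap.toContinuousLinearMap (LieModule.toEnd ℝ Alg V Z)) φ +
    lieDeriv Z φ

theorem lieAction_apply (Z : Alg) (φ : 𝓓'(U, V)) (f : 𝓓(U, ℝ)) :
    lieAction Z φ f = ⁅Z, φ f⁆ - φ (lieDerivTest Z f) := by
  rw [sub_eq_add_neg]
  rfl

/-- `φ` is locally invariant if it is killed by the action of every `Z` in `sl(2, ℝ)`. -/
def IsLocallyInvariant (φ : 𝓓'(U, V)) : Prop :=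
  ∀ Z : Alg, lieAction Z φ = 0

end SL2

end

open scoped Distributions LineDeriv

noncomputable section

namespace SL2

/-! ### Commutation formulas in an algebra containing an `sl₂`-triple. -/

section Sl2Algebra

variable {A : Type*} [Ring A] [Algebra ℝ A] {e f h : A}

/-! The Casimir operator `e`, multiplication `f` by `-½(h² + xy)` and the shifted Euler operator
form an `sl₂`-triple commuting with the adjoint vector fields (`WeylRelations`). Restrict `φ` to
test functions supported in a compact set stable under rotations, and let the triple act on the
resulting equivariant functional `ψ` by composition on the right. Since `ψ` has finite order and
vanishes off the cone, some `f ^ M` kills it (`exists_comp_opF_pow_eq_zero`). Since `φ` is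
`□`-finite, a nonzero polynomial in `e` kills it as well.

By `sl₂` theory, a nonzero such `ψ` would produce a nonzero equivariant functional killed by `f`
with Euler weight `j ∈ ℕ` (`eq_zero_of_comp_aeval_eq_zero_of_comp_pow_eq_zero`). The two commuting
`sl₂`-actions have Casimir elements related by `WeylRelations.casimir_eq`, so the range of that
functional, a subrepresentation of `V`, has Casimir eigenvalue `n(n + 2)` with `n = 2j + 1` odd.
Hence `X - Y` has an eigenvalue `i m` with `m` odd on its complexification
(`exists_odd_not_injective`).

But rotation by `π` is `-1 ∈ SL(2, ℝ)`, which acts trivially on the Lie algebra, so on test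
functions only even frequencies occur: `(X - Y)² + m²` is surjective there for odd `m`
(`surjective_opLie_sq_add`), hence invertible on the finite dimensional range. This parity clash
proves the theorem. -/

theorem mul_aeval_of_sl2 (hhe : h * e = e * h + (2 : ℝ) • e) (hef : e * f = f * e + h)
    (p : Polynomial ℝ) :
    f * Polynomial.aeval e p = Polynomial.aeval e p * f
      - Polynomial.aeval e p.derivative * h
      - Polynomial.aeval e p.derivative.derivative * e := by
  induction p using Polynomial.induction_on with
  | C a => simp [Algebra.commutes a f]
  | add p q hp hq =>
    simp only [map_add, mul_add, add_mul, hp, hq]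
    abel
  | monomial n a ih =>
    rw [pow_succ, ← mul_assoc]
    set p := Polynomial.C a * Polynomial.X ^ n
    have h1 : (p * Polynomial.X).derivative = p.derivative * Polynomial.X + p := by
      simp
    have h2 : (p * Polynomial.X).derivative.derivative
        = p.derivative.derivative * Polynomial.X + (2 : ℝ) • p.derivative := by
      rw [h1]
      simp [two_smul, add_assoc]
    rw [h2, h1]
    simp only [map_mul, map_add, map_smul, Polynomial.aeval_X]
    have hc : Polynomial.aeval e p.derivative * e = e * Polynomial.aeval e p.derivative := by
      have := Polynomial.aeval_mul (x := e) (p := p.derivative) (q := Polynomial.X)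
      rw [mul_comm, Polynomial.aeval_mul] at this
      simpa using this.symm
    rw [← mul_assoc, ih, sub_mul, sub_mul, mul_assoc _ f e, mul_assoc _ h e, hhe,
      eq_sub_of_add_eq hef.symm, mul_assoc _ e f, hef]
    simp only [mul_add, mul_sub, add_mul, smul_mul_assoc, mul_smul_comm, mul_assoc]
    abel

/-- The Cartan factor stands to the left of `e ^ k`, so that it acts directly on a functional
composed from the left. -/
theorem pow_succ_mul_of_sl2 (hhe : h * e = e * h + (2 : ℝ) • e) (hef : e * f = f * e + h)
    (k : ℕ) : e ^ (k + 1) * f = f * e ^ (k + 1) + ((k : ℝ) + 1) • ((h - (k : ℝ) • 1) * e ^ k) := by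
  induction k with
  | zero => simp [hef]
  | succ k ih =>
    have hk : ∀ k : ℕ, e ^ k * h = h * e ^ k - (2 * (k : ℝ)) • e ^ k := by
      intro k
      induction k with
      | zero => simp
      | succ k ih =>
        rw [pow_succ', mul_assoc, ih, mul_sub, ← mul_assoc, eq_sub_of_add_eq hhe.symm]
        simp only [sub_mul, mul_assoc, smul_mul_assoc, mul_smul_comm, Nat.cast_succ]
        module
    rw [pow_succ' e (k + 1), mul_assoc, ih, mul_add, ← mul_assoc, hef]
    simp only [sub_mul, add_mul, mul_sub, mul_smul_comm, ← mul_assoc, smul_mul_assoc, one_mul,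
      eq_sub_of_add_eq hhe.symm]
    simp only [mul_assoc, ← pow_succ']
    push_cast
    module

end Sl2Algebra

/-! ### Extremal functionals for an `sl₂`-triple acting by right composition. -/

section LowestWeight

variable {D V : Type*} [AddCommGroup D] [Module ℝ D] [AddCommGroup V] [Module ℝ V]
  {e f h : Module.End ℝ D}

/-- A Verma module argument: only weights `j ∈ ℕ` allow an extremal vector to be reached again from
its descendants, and `hinj` excludes these weights. Composing a relation with `f` lowers its degree
in `e` by one. -/
theorem eq_zero_of_sum_comp_pow_eq_zero (hhe : h * e = e * h + (2 : ℝ) • e)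
    (hef : e * f = f * e + h) (hhf : h * f = f * h - (2 : ℝ) • f)
    (W : Submodule ℝ (D →ₗ[ℝ] V)) (hWh : ∀ ψ ∈ W, ψ ∘ₗ h ∈ W)
    (hinj : ∀ j : ℕ, ∀ ψ ∈ W, ψ ∘ₗ f = 0 → ψ ∘ₗ (h - (j : ℝ) • 1) = 0 → ψ = 0)
    (d : ℕ) (s : ℕ → D →ₗ[ℝ] V) (hs : ∀ j, s j ∈ W) (hsf : ∀ j, s j ∘ₗ f = 0)
    (hsum : ∑ j ∈ Finset.range d, s j ∘ₗ (e ^ j) = 0) : ∀ j < d, s j = 0 := by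
  induction d generalizing s with
  | zero => simp
  | succ d ih =>
    have key : ∀ j < d, ((j : ℝ) + 1) • s (j + 1) ∘ₗ (h - (j : ℝ) • 1) = 0 := by
      refine ih (fun j => ((j : ℝ) + 1) • s (j + 1) ∘ₗ (h - (j : ℝ) • 1)) ?_ ?_ ?_
      · intro j
        refine W.smul_mem _ ?_
        rw [LinearMap.comp_sub, LinearMap.comp_smul]
        exact W.sub_mem (hWh _ (hs _)) (W.smul_mem _ (hs _))
      · intro j
        have : (h - (j : ℝ) • 1) * f = f * (h - (j : ℝ) • 1) - (2 : ℝ) • f := by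
          simp only [sub_mul, mul_sub, hhf, smul_mul_assoc, mul_smul_comm, one_mul, mul_one]
          abel
        rw [LinearMap.smul_comp, LinearMap.comp_assoc, ← Module.End.mul_eq_comp, this,
          LinearMap.comp_sub, LinearMap.comp_smul, Module.End.mul_eq_comp,
          ← LinearMap.comp_assoc, hsf]
        simp
      -- Moving `f` leftwards through `e ^ (j + 1)` leaves `(j + 1) (h - j) e ^ j`, because `s (j +
      -- 1)` kills `f`; the term `j = 0` vanishes outright.
      · have h0 := congrArg (fun ψ => ψ ∘ₗ f) hsum
        simp only [Finset.sum_range_succ', LinearMap.add_comp, pow_zero, LinearMap.zero_comp] at h0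
        rw [Module.End.one_eq_id, LinearMap.comp_id, hsf, add_zero] at h0
        rw [← h0]
        ext x
        simp only [LinearMap.sum_apply, LinearMap.comp_apply]
        refine Finset.sum_congr rfl fun j _ => ?_
        have h1 := LinearMap.congr_fun (pow_succ_mul_of_sl2 hhe hef j) x
        have h2 := LinearMap.congr_fun (hsf (j + 1)) ((e ^ (j + 1)) x)
        simp only [Module.End.mul_apply, LinearMap.add_apply, LinearMap.smul_apply] at h1
        rw [h1, map_add]
        simp only [LinearMap.comp_apply, LinearMap.zero_apply] at h2
        rw [h2]
        simp
    have hpos : ∀ j < d, s (j + 1) = 0 := by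
      intro j hj
      have h1 : ((j : ℝ) + 1) ≠ 0 := by positivity
      exact hinj j _ (hs _) (hsf _) ((smul_eq_zero.mp (key j hj)).resolve_left h1)
    intro j hj
    rcases j with _ | j
    · rw [Finset.sum_range_succ', Finset.sum_eq_zero, zero_add] at hsum
      · simpa [Module.End.one_eq_id] using hsum
      · intro i hi
        rw [hpos i (Finset.mem_range.mp hi), LinearMap.zero_comp]
    · exact hpos j (by omega)

/-- Induction on the power of `f`: `ψ ∘ f` is again annihilated by a polynomial in `e`, so it
vanishes, and then the relation `p(e)` on the extremal `ψ` must be trivial. -/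
theorem eq_zero_of_comp_aeval_eq_zero_of_comp_pow_eq_zero
    (hhe : h * e = e * h + (2 : ℝ) • e)
    (hef : e * f = f * e + h) (hhf : h * f = f * h - (2 : ℝ) • f)
    (W : Submodule ℝ (D →ₗ[ℝ] V)) (hWh : ∀ ψ ∈ W, ψ ∘ₗ h ∈ W) (hWf : ∀ ψ ∈ W, ψ ∘ₗ f ∈ W)
    (hinj : ∀ j : ℕ, ∀ ψ ∈ W, ψ ∘ₗ f = 0 → ψ ∘ₗ (h - (j : ℝ) • 1) = 0 → ψ = 0)
    (N : ℕ) (ψ : D →ₗ[ℝ] V) (hψ : ψ ∈ W) (hN : ψ ∘ₗ (f ^ N) = 0)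
    (p : Polynomial ℝ) (hp : p ≠ 0) (hψp : ψ ∘ₗ (Polynomial.aeval e p) = 0) : ψ = 0 := by
  induction N generalizing ψ p with
  | zero => simpa [Module.End.one_eq_id] using hN
  | succ N ih =>
    have hf0 : ψ ∘ₗ f = 0 := by
      -- Moving `f` across a polynomial in `e` differentiates at most twice, so the cube of `p`
      -- leaves at least one factor `p` in every term.
      refine ih _ (hWf _ hψ) ?_ (p ^ 3) (pow_ne_zero _ hp) ?_
      · rw [LinearMap.comp_assoc, ← Module.End.mul_eq_comp, ← pow_succ', hN]
      · have hdvd : ∀ g : Polynomial ℝ, p ∣ g → ∀ a : Module.End ℝ D,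
            ψ ∘ₗ (Polynomial.aeval e g * a) = 0 := by
          rintro _ ⟨g, rfl⟩ a
          rw [map_mul, mul_assoc, Module.End.mul_eq_comp, ← LinearMap.comp_assoc, hψp,
            LinearMap.zero_comp]
        have h1 : p ^ 2 ∣ (p ^ 3).derivative := by
          rw [Polynomial.derivative_pow]
          exact ⟨Polynomial.C 3 * p.derivative, by simp; ring⟩
        have h2 : p ∣ (p ^ 3).derivative.derivative := by
          obtain ⟨g, hg⟩ := h1
          rw [hg, Polynomial.derivative_mul, Polynomial.derivative_pow]
          exact ⟨Polynomial.C 2 * p.derivative * g + p * g.derivative, by simp; ring⟩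
        rw [LinearMap.comp_assoc, ← Module.End.mul_eq_comp, mul_aeval_of_sl2 hhe hef,
          LinearMap.comp_sub, LinearMap.comp_sub, hdvd _ (dvd_pow_self p (by norm_num)),
          hdvd _ ((dvd_pow_self p (by norm_num)).trans h1), hdvd _ h2]
        simp
    have h0 := eq_zero_of_sum_comp_pow_eq_zero hhe hef hhf W hWh hinj (p.natDegree + 1)
      (fun j => p.coeff j • ψ) (fun j => W.smul_mem _ hψ)
      (fun j => by rw [LinearMap.smul_comp, hf0, smul_zero]) (by
        rw [← hψp, Polynomial.aeval_eq_sum_range]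
        ext x
        simp [LinearMap.sum_apply])
    -- The leading coefficient is nonzero, so its vanishing multiple of `ψ` forces `ψ = 0`.
    have h1 := h0 p.natDegree (by omega)
    exact (smul_eq_zero.mp h1).resolve_left (by simpa using hp)

end LowestWeight

/-! ### Parity of the weights of `X - Y`. -/

section Parity

/-- At the top of a string of eigenvalues with step `2`, the vector is killed by `e`, so the Casimir
relation reads `c(c + 2) = n(n + 2)`; both roots `n` and `-n - 2` are odd integers. -/
theorem exists_odd_eigenvector {M : Type*} [AddCommGroup M] [Module ℂ M] [FiniteDimensional ℂ M]
    [Nontrivial M] {k e f : Module.End ℂ M} (hke : k * e = e * k + (2 : ℂ) • e) (n : ℕ)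
    (hn : Odd n) (hc : k * k + (2 : ℂ) • k + (4 : ℂ) • (f * e) = ((n : ℂ) * (n + 2)) • 1) :
    ∃ m : ℤ, Odd m ∧ ∃ v ≠ 0, k v = (m : ℂ) • v := by
  obtain ⟨c, hc', hmax⟩ : ∃ c, k.HasEigenvalue c ∧ ¬ k.HasEigenvalue (c + 2) := by
    obtain ⟨c₀, hc₀⟩ := Module.End.exists_eigenvalue k
    by_contra! hcon
    have hall : ∀ j : ℕ, k.HasEigenvalue (c₀ + 2 * j) := by
      intro j
      induction j with
      | zero => simpa using hc₀
      | succ j ih =>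
        have := hcon _ ih
        push_cast
        rwa [mul_add, mul_one, ← add_assoc]
    have hfin := Module.End.finite_hasEigenvalue k
    refine Set.infinite_of_injective_forall_mem (f := fun j : ℕ => c₀ + 2 * (j : ℂ)) ?_ hall hfin
    intro a b hab
    simpa using hab
  obtain ⟨v, hv⟩ := hc'.exists_hasEigenvector
  have hkv : k v = c • v := hv.apply_eq_smul
  have hev : e v = 0 := by
    by_contra hne
    refine hmax (Module.End.hasEigenvalue_of_hasEigenvector (x := e v) ⟨?_, hne⟩)
    rw [Module.End.mem_eigenspace_iff]
    have := LinearMap.congr_fun hke v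
    simp only [Module.End.mul_apply, LinearMap.add_apply, LinearMap.smul_apply, hkv,
      map_smul] at this
    rw [this, add_smul]
  have h1 := LinearMap.congr_fun hc v
  simp only [Module.End.mul_apply, LinearMap.add_apply, LinearMap.smul_apply, hkv, hev,
      map_smul, map_zero, smul_zero, add_zero, Module.End.one_apply, smul_smul, ← add_smul] at h1
  have h2 := smul_left_injective ℂ hv.2 h1
  have h3 : (c - n) * (c + n + 2) = 0 := by linear_combination h2
  rcases mul_eq_zero.mp h3 with h4 | h4
  · refine ⟨n, by exact_mod_cast hn, v, hv.2, ?_⟩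
    rw [hkv, sub_eq_zero.mp h4]
    simp
  · refine ⟨-n - 2, ?_, v, hv.2, ?_⟩
    · have : Odd (n : ℤ) := by exact_mod_cast hn
      exact this.neg.sub_even even_two
    · rw [hkv]
      congr 1
      push_cast
      linear_combination h4

/-- `X - Y` spans a compact Cartan subalgebra, diagonalized only over `ℂ`; the conclusion is phrased
with a real operator so that it can be compared with test functions. -/
theorem exists_odd_not_injective {M : Type*} [AddCommGroup M] [Module ℝ M] [FiniteDimensional ℝ M]
    [Nontrivial M] {h x y : Module.End ℝ M} (hhx : h * x = x * h + (2 : ℝ) • x)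
    (hhy : h * y = y * h - (2 : ℝ) • y) (hxy : x * y = y * x + h) (n : ℕ) (hn : Odd n)
    (hc : h * h + (2 : ℝ) • h + (4 : ℝ) • (y * x) = ((n : ℝ) * (n + 2)) • 1) :
    ∃ m : ℤ, Odd m ∧
      ¬ Function.Injective ((x - y) * (x - y) + ((m : ℝ) ^ 2) • (1 : Module.End ℝ M)) := by
  let β : Module.End ℝ M →ₐ[ℝ] Module.End ℂ (TensorProduct ℝ ℂ M) :=
    Module.End.baseChangeHom ℝ ℂ M
  have hsm : ∀ (r : ℝ) (a : Module.End ℝ M), β (r • a) = (r : ℂ) • β a := by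
    intro r a
    rw [map_smul, ← algebraMap_smul ℂ r (β a)]
    rfl
  have hhx' := congrArg β hhx
  have hhy' := congrArg β hhy
  have hxy' := congrArg β hxy
  have hc' := congrArg β hc
  simp only [map_mul, map_add, map_sub, hsm, map_one] at hhx' hhy' hxy' hc'
  push_cast at hhx' hhy' hc'
  set H := β h
  set X := β x
  set Y := β y
  have hI : Complex.I * Complex.I = -1 := Complex.I_mul_I
  -- Cayley transform: an `sl₂`-triple with Cartan element `-i(X - Y)` and the same Casimir element.
  obtain ⟨m, hm, v, hv0, hv⟩ := exists_odd_eigenvector (k := -Complex.I • (X - Y))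
    (e := (1 / 2 : ℂ) • (H + Complex.I • (X + Y))) (f := (1 / 2 : ℂ) • (H - Complex.I • (X + Y)))
    (by
      simp only [smul_mul_assoc, mul_smul_comm, mul_add, mul_sub, add_mul, sub_mul, hxy', hhx',
        hhy']
      match_scalars <;> first
        | ring1
        | linear_combination -hI)
    n hn (by
      rw [← hc']
      simp only [smul_mul_assoc, mul_smul_comm, mul_add, mul_sub, add_mul, sub_mul, hxy', hhx',
        hhy']
      match_scalars <;> first
        | ring1
        | linear_combination -hI
        | linear_combination -2 * hI
        | linear_combination -4 * hI)
  refine ⟨m, hm, fun hinj => hv0 ?_⟩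
  -- In finite dimension injectivity gives a unit, and units survive base change, whereas the
  -- complexified operator kills `v`.
  have hunit := ((Module.End.isUnit_iff _).mpr
    ⟨hinj, LinearMap.injective_iff_surjective.mp hinj⟩).map β
  refine ((Module.End.isUnit_iff _).mp hunit).1 ?_
  have h1 : (X - Y) v = (Complex.I * m) • v := by
    rw [mul_smul, ← hv, LinearMap.smul_apply, smul_smul, mul_neg, hI, neg_neg, one_smul]
  simp only [map_mul, map_add, map_sub, hsm, map_one, LinearMap.add_apply, Module.End.mul_apply,
    LinearMap.smul_apply, Module.End.one_apply, map_zero]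
  change (X - Y) ((X - Y) v) + _ = _
  rw [h1, map_smul, h1, smul_smul, ← add_smul]
  convert zero_smul ℂ v using 2
  push_cast
  linear_combination ((m : ℂ) ^ 2) * hI

/-- Were `ψ` nonzero, its range would be a nonzero representation on which `hcas` fixes an odd-type
Casimir eigenvalue, while `hsurj` descends from `D` to this range and forbids odd frequencies. -/
theorem eq_zero_of_comp_sub_natCast_eq_zero {D V : Type*} [AddCommGroup D] [Module ℝ D]
    [AddCommGroup V] [Module ℝ V] [FiniteDimensional ℝ V]
    {a b c : Module.End ℝ V} (hab : a * b = b * a + (2 : ℝ) • b)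
    (hac : a * c = c * a - (2 : ℝ) • c) (hbc : b * c = c * b + a)
    {A B C e f h : Module.End ℝ D}
    (hcas : A * A + (2 : ℝ) • A + (4 : ℝ) • (C * B) =
      (4 : ℝ) • (h * h + (2 : ℝ) • h + (4 : ℝ) • (f * e)) + (3 : ℝ) • 1)
    (hsurj : ∀ m : ℤ, Odd m →
      Function.Surjective ((B - C) * (B - C) + ((m : ℝ) ^ 2) • (1 : Module.End ℝ D)))
    (ψ : D →ₗ[ℝ] V) (hA : ∀ d, a (ψ d) = ψ (A d)) (hB : ∀ d, b (ψ d) = ψ (B d))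
    (hC : ∀ d, c (ψ d) = ψ (C d)) (hf : ψ ∘ₗ f = 0) (j : ℕ)
    (hj : ψ ∘ₗ (h - (j : ℝ) • 1) = 0) : ψ = 0 := by
  by_contra hne
  have hnt : Nontrivial (LinearMap.range ψ) := by
    rw [Submodule.nontrivial_iff_ne_bot]
    exact fun h0 => hne (LinearMap.range_eq_bot.mp h0)
  have ha' : ∀ v ∈ LinearMap.range ψ, a v ∈ LinearMap.range ψ := by
    rintro _ ⟨d, rfl⟩
    exact ⟨_, (hA d).symm⟩
  have hb' : ∀ v ∈ LinearMap.range ψ, b v ∈ LinearMap.range ψ := by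
    rintro _ ⟨d, rfl⟩
    exact ⟨_, (hB d).symm⟩
  have hc' : ∀ v ∈ LinearMap.range ψ, c v ∈ LinearMap.range ψ := by
    rintro _ ⟨d, rfl⟩
    exact ⟨_, (hC d).symm⟩
  have hh : ∀ d, ψ (h d) = (j : ℝ) • ψ d := fun d => by
    simpa [sub_eq_zero] using LinearMap.congr_fun hj d
  have hf' : ∀ d, ψ (f d) = 0 := LinearMap.congr_fun hf
  -- With `h = j` and the term `f * e` killed, the Casimir scalar is `4(j² + 2j) + 3 = n(n + 2)` for
  -- `n = 2j + 1`.
  obtain ⟨m, hm, hninj⟩ := exists_odd_not_injective (h := a.restrict ha') (x := b.restrict hb')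
    (y := c.restrict hc')
    (by ext ⟨v, hv⟩; simpa using LinearMap.congr_fun hab v)
    (by ext ⟨v, hv⟩; simpa using LinearMap.congr_fun hac v)
    (by ext ⟨v, hv⟩; simpa using LinearMap.congr_fun hbc v)
    (2 * j + 1) (by simp) (by
      ext ⟨_, d, rfl⟩
      have h1 := congrArg ψ (LinearMap.congr_fun hcas d)
      simp only [LinearMap.add_apply, Module.End.mul_apply, LinearMap.smul_apply, map_add,
        map_smul, hh, hf', Module.End.one_apply, ← hA, ← hB, ← hC] at h1
      simp only [LinearMap.add_apply, Module.End.mul_apply, LinearMap.smul_apply,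
        Module.End.one_apply, Submodule.coe_add, Submodule.coe_smul, LinearMap.coe_restrict_apply]
      rw [h1]
      push_cast
      module)
  refine hninj (LinearMap.injective_iff_surjective.mpr ?_)
  rintro ⟨_, d, rfl⟩
  obtain ⟨d', rfl⟩ := hsurj m hm d
  refine ⟨⟨ψ d', d', rfl⟩, ?_⟩
  ext
  simp [hB, hC]

end Parity

/-! ### The two commuting `sl₂`-actions in the Weyl algebra of three variables. -/

section Weyl

variable {A : Type*} [Ring A]

/-- Three position operators `h, x, y` and the corresponding partial derivatives `a, b, c`. -/
structure WeylRelations (h x y a b c : A) : Prop where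
  xh : x * h = h * x
  yh : y * h = h * y
  yx : y * x = x * y
  ba : b * a = a * b
  ca : c * a = a * c
  cb : c * b = b * c
  ah : a * h = h * a + 1
  bx : b * x = x * b + 1
  cy : c * y = y * c + 1
  ax : a * x = x * a
  ay : a * y = y * a
  bh : b * h = h * b
  by' : b * y = y * b
  ch : c * h = h * c
  cx : c * x = x * c

namespace WeylRelations

variable {h x y a b c : A}

/-- The rewriting rules which bring a product to normal order. -/
theorem normal_order (r : WeylRelations h x y a b c) :
    (x * h = h * x) ∧
    (y * h = h * y) ∧
    (y * x = x * y) ∧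
    (b * a = a * b) ∧
    (c * a = a * c) ∧
    (c * b = b * c) ∧
    (a * h = h * a + 1) ∧
    (b * x = x * b + 1) ∧
    (c * y = y * c + 1) ∧
    (a * x = x * a) ∧
    (a * y = y * a) ∧
    (b * h = h * b) ∧
    (b * y = y * b) ∧
    (c * h = h * c) ∧
    (c * x = x * c) ∧
    (∀ t, x * (h * t) = (h * x) * t) ∧
    (∀ t, y * (h * t) = (h * y) * t) ∧
    (∀ t, y * (x * t) = (x * y) * t) ∧
    (∀ t, b * (a * t) = (a * b) * t) ∧
    (∀ t, c * (a * t) = (a * c) * t) ∧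
    (∀ t, c * (b * t) = (b * c) * t) ∧
    (∀ t, a * (h * t) = (h * a + 1) * t) ∧
    (∀ t, b * (x * t) = (x * b + 1) * t) ∧
    (∀ t, c * (y * t) = (y * c + 1) * t) ∧
    (∀ t, a * (x * t) = (x * a) * t) ∧
    (∀ t, a * (y * t) = (y * a) * t) ∧
    (∀ t, b * (h * t) = (h * b) * t) ∧
    (∀ t, b * (y * t) = (y * b) * t) ∧
    (∀ t, c * (h * t) = (h * c) * t) ∧
    (∀ t, c * (x * t) = (x * c) * t) := by
  refine ⟨r.xh, r.yh, r.yx, r.ba, r.ca, r.cb, r.ah, r.bx, r.cy, r.ax, r.ay, r.bh, r.by', r.ch, r.cx,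
    ?_, ?_, ?_, ?_, ?_, ?_, ?_, ?_, ?_, ?_, ?_, ?_, ?_, ?_, ?_⟩ <;> intro t <;> rw [← mul_assoc]
  exacts [congrArg (· * t) r.xh, congrArg (· * t) r.yh, congrArg (· * t) r.yx,
    congrArg (· * t) r.ba, congrArg (· * t) r.ca, congrArg (· * t) r.cb, congrArg (· * t) r.ah,
    congrArg (· * t) r.bx, congrArg (· * t) r.cy, congrArg (· * t) r.ax, congrArg (· * t) r.ay,
    congrArg (· * t) r.bh, congrArg (· * t) r.by', congrArg (· * t) r.ch, congrArg (· * t) r.cx]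

end WeylRelations

variable [Algebra ℝ A]

/-- The operator `½ ∂_h² + 2 ∂_x ∂_y`. -/
def weylE (a b c : A) : A := (1 / 2 : ℝ) • (a * a) + (2 : ℝ) • (b * c)

/-- Multiplication by `-½ (h² + x y)`. -/
def weylF (h x y : A) : A := (-1 / 2 : ℝ) • (h * h + x * y)

/-- The shifted Euler operator `-(h ∂_h + x ∂_x + y ∂_y + 3/2)`. -/
def weylH (h x y a b c : A) : A := -(h * a + x * b + y * c + (3 / 2 : ℝ) • 1)

/-- The vector field `W ↦ -⁅H, W⁆`. -/
def weylLH (x y b c : A) : A := (-2 : ℝ) • (x * b) + (2 : ℝ) • (y * c)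

/-- The vector field `W ↦ -⁅X, W⁆`. -/
def weylLX (h y a b : A) : A := (2 : ℝ) • (h * b) - y * a

/-- The vector field `W ↦ -⁅Y, W⁆`. -/
def weylLY (h x a c : A) : A := x * a - (2 : ℝ) • (h * c)

namespace WeylRelations

variable {h x y a b c : A}

-- This identity and the following ones are checked by normal ordering. The shift `3/2` in `weylH`,
-- half the dimension, makes `[weylE, weylF] = weylH` hold without an extra constant.
set_option linter.unusedSimpArgs false in
theorem weylH_mul_weylE (r : WeylRelations h x y a b c) :
    weylH h x y a b c * weylE a b c = weylE a b c * weylH h x y a b c + (2 : ℝ) • weylE a b c := by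
  simp only [weylE, weylH, mul_add, add_mul, mul_sub, sub_mul, mul_neg, neg_mul,
    smul_mul_assoc, mul_smul_comm, smul_add, smul_sub, smul_neg, mul_assoc, mul_one, one_mul,
    r.normal_order]
  module

set_option linter.unusedSimpArgs false in
theorem weylE_mul_weylF (r : WeylRelations h x y a b c) :
    weylE a b c * weylF h x y = weylF h x y * weylE a b c + weylH h x y a b c := by
  simp only [weylE, weylF, weylH, mul_add, add_mul, mul_sub, sub_mul, mul_neg, neg_mul,
    smul_mul_assoc, mul_smul_comm, smul_add, smul_sub, smul_neg, mul_assoc, mul_one, one_mul,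
    r.normal_order]
  module

set_option linter.unusedSimpArgs false in
theorem weylH_mul_weylF (r : WeylRelations h x y a b c) :
    weylH h x y a b c * weylF h x y = weylF h x y * weylH h x y a b c - (2 : ℝ) • weylF h x y := by
  simp only [weylF, weylH, mul_add, add_mul, mul_sub, sub_mul, mul_neg, neg_mul,
    smul_mul_assoc, mul_smul_comm, smul_add, smul_sub, smul_neg, mul_assoc, mul_one, one_mul,
    r.normal_order]
  module

set_option linter.unusedSimpArgs false in
theorem weylLH_mul_weylF (r : WeylRelations h x y a b c) :
    weylLH x y b c * weylF h x y = weylF h x y * weylLH x y b c := by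
  simp only [weylLH, weylF, mul_add, add_mul, mul_sub, sub_mul, mul_neg, neg_mul,
    smul_mul_assoc, mul_smul_comm, smul_add, smul_sub, smul_neg, mul_assoc, mul_one, one_mul,
    r.normal_order]
  module

set_option linter.unusedSimpArgs false in
theorem weylLH_mul_weylH (r : WeylRelations h x y a b c) :
    weylLH x y b c * weylH h x y a b c = weylH h x y a b c * weylLH x y b c := by
  simp only [weylLH, weylH, mul_add, add_mul, mul_sub, sub_mul, mul_neg, neg_mul,
    smul_mul_assoc, mul_smul_comm, smul_add, smul_sub, smul_neg, mul_assoc, mul_one, one_mul,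
    r.normal_order]
  module

set_option linter.unusedSimpArgs false in
theorem weylLX_mul_weylF (r : WeylRelations h x y a b c) :
    weylLX h y a b * weylF h x y = weylF h x y * weylLX h y a b := by
  simp only [weylLX, weylF, mul_add, add_mul, mul_sub, sub_mul, mul_neg, neg_mul,
    smul_mul_assoc, mul_smul_comm, smul_add, smul_sub, smul_neg, mul_assoc, mul_one, one_mul,
    r.normal_order]
  module

set_option linter.unusedSimpArgs false in
theorem weylLX_mul_weylH (r : WeylRelations h x y a b c) :
    weylLX h y a b * weylH h x y a b c = weylH h x y a b c * weylLX h y a b := by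
  simp only [weylLX, weylH, mul_add, add_mul, mul_sub, sub_mul, mul_neg, neg_mul,
    smul_mul_assoc, mul_smul_comm, smul_add, smul_sub, smul_neg, mul_assoc, mul_one, one_mul,
    r.normal_order]
  module

set_option linter.unusedSimpArgs false in
theorem weylLY_mul_weylF (r : WeylRelations h x y a b c) :
    weylLY h x a c * weylF h x y = weylF h x y * weylLY h x a c := by
  simp only [weylLY, weylF, mul_add, add_mul, mul_sub, sub_mul, mul_neg, neg_mul,
    smul_mul_assoc, mul_smul_comm, smul_add, smul_sub, smul_neg, mul_assoc, mul_one, one_mul,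
    r.normal_order]
  module

set_option linter.unusedSimpArgs false in
theorem weylLY_mul_weylH (r : WeylRelations h x y a b c) :
    weylLY h x a c * weylH h x y a b c = weylH h x y a b c * weylLY h x a c := by
  simp only [weylLY, weylH, mul_add, add_mul, mul_sub, sub_mul, mul_neg, neg_mul,
    smul_mul_assoc, mul_smul_comm, smul_add, smul_sub, smul_neg, mul_assoc, mul_one, one_mul,
    r.normal_order]
  module

-- The analogue of writing the angular Laplacian through the Euler operator, the quadratic form and
-- the Laplacian. The constant `3` compensates the shift by `3/2`, and is what makes the resulting
-- weights odd.
set_option linter.unusedSimpArgs false in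
theorem casimir_eq (r : WeylRelations h x y a b c) :
    weylLH x y b c * weylLH x y b c + (2 : ℝ) • weylLH x y b c +
      (4 : ℝ) • (weylLY h x a c * weylLX h y a b) =
    (4 : ℝ) • (weylH h x y a b c * weylH h x y a b c + (2 : ℝ) • weylH h x y a b c +
      (4 : ℝ) • (weylF h x y * weylE a b c)) + (3 : ℝ) • 1 := by
  simp only [weylE, weylF, weylH, weylLH, weylLX, weylLY, mul_add, add_mul, mul_sub, sub_mul, mul_neg, neg_mul,
    smul_mul_assoc, mul_smul_comm, smul_add, smul_sub, smul_neg, mul_assoc, mul_one, one_mul,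
    r.normal_order]
  module

end WeylRelations
end Weyl

/-! ### Coordinates on the Lie algebra and the invariant quadratic form. -/

section Coordinates

/-- The coordinate of `H`. -/
def coordH : Alg →L[ℝ] ℝ :=
  LinearMap.toContinuousLinearMap ((Matrix.entryLinearMap ℝ ℝ (0 : Fin 2) (0 : Fin 2)) ∘ₗ toMatrix)

/-- The coordinate of `X`. -/
def coordX : Alg →L[ℝ] ℝ :=
  LinearMap.toContinuousLinearMap ((Matrix.entryLinearMap ℝ ℝ (0 : Fin 2) (1 : Fin 2)) ∘ₗ toMatrix)

/-- The coordinate of `Y`. -/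
def coordY : Alg →L[ℝ] ℝ :=
  LinearMap.toContinuousLinearMap ((Matrix.entryLinearMap ℝ ℝ (1 : Fin 2) (0 : Fin 2)) ∘ₗ toMatrix)

theorem coordH_apply (W : Alg) : coordH W = toMatrix W 0 0 := rfl
theorem coordX_apply (W : Alg) : coordX W = toMatrix W 0 1 := rfl
theorem coordY_apply (W : Alg) : coordY W = toMatrix W 1 0 := rfl

@[simp] theorem toMatrix_H : toMatrix H = !![1, 0; 0, -1] := rfl
@[simp] theorem toMatrix_X : toMatrix X = !![0, 1; 0, 0] := rfl
@[simp] theorem toMatrix_Y : toMatrix Y = !![0, 0; 1, 0] := rfl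

theorem toMatrix_one_one (W : Alg) : toMatrix W 1 1 = -toMatrix W 0 0 := by
  have := trace_toMatrix W
  rw [Matrix.trace_fin_two] at this
  linarith

theorem ext_coord {W W' : Alg} (hH : coordH W = coordH W') (hX : coordX W = coordX W')
    (hY : coordY W = coordY W') : W = W' := by
  apply toMatrix_injective
  ext i j
  fin_cases i <;> fin_cases j
  · exact hH
  · exact hX
  · exact hY
  · change toMatrix W 1 1 = toMatrix W' 1 1
    rw [toMatrix_one_one, toMatrix_one_one]
    exact congrArg Neg.neg hH

theorem eq_coord (W : Alg) : W = coordH W • H + coordX W • X + coordY W • Y := by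
  apply ext_coord <;> simp [coordH_apply, coordX_apply, coordY_apply]

theorem lie_H_X : ⁅H, X⁆ = (2 : ℝ) • X := by
  apply ext_coord <;> norm_num [coordH_apply, coordX_apply, coordY_apply, toMatrix_lie]

theorem lie_H_Y : ⁅H, Y⁆ = (-2 : ℝ) • Y := by
  apply ext_coord <;> norm_num [coordH_apply, coordX_apply, coordY_apply, toMatrix_lie]

theorem lie_X_Y : ⁅X, Y⁆ = H := by
  apply ext_coord <;> simp [coordH_apply, coordX_apply, coordY_apply, toMatrix_lie]

theorem negAd_H (W : Alg) : negAd H W = (-2 * coordX W) • X + (2 * coordY W) • Y := by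
  change -⁅H, W⁆ = _
  conv_lhs => rw [eq_coord W]
  simp only [lie_add, lie_smul, lie_self, lie_H_X, lie_H_Y]
  module

theorem negAd_X (W : Alg) : negAd X W = (2 * coordH W) • X - coordY W • H := by
  change -⁅X, W⁆ = _
  conv_lhs => rw [eq_coord W]
  simp only [lie_add, lie_smul, lie_self, ← lie_skew X H, lie_H_X, lie_X_Y]
  module

theorem negAd_Y (W : Alg) : negAd Y W = coordX W • H - (2 * coordH W) • Y := by
  change -⁅Y, W⁆ = _
  conv_lhs => rw [eq_coord W]
  simp only [lie_add, lie_smul, lie_self, ← lie_skew Y H, ← lie_skew Y X, lie_H_Y, lie_X_Y]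
  module

/-- The invariant quadratic form `h² + x y`, the negative of the determinant. -/
def quad (W : Alg) : ℝ := coordH W * coordH W + coordX W * coordY W

theorem contDiff_quad {n : WithTop ℕ∞} : ContDiff ℝ n quad :=
  (coordH.contDiff.mul coordH.contDiff).add (coordX.contDiff.mul coordY.contDiff)

theorem quad_eq_zero_of_mem_nilpotentCone {W : Alg} (hW : W ∈ nilpotentCone) : quad W = 0 := by
  have h1 : IsNilpotent (toMatrix W).det := by
    obtain ⟨n, hn⟩ := hW
    refine ⟨n + 1, ?_⟩
    rw [← Matrix.det_pow, pow_succ, hn, zero_mul, Matrix.det_zero]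
  have h2 := h1.eq_zero
  rw [Matrix.det_fin_two, toMatrix_one_one] at h2
  rw [quad, coordH_apply, coordX_apply, coordY_apply]
  linarith

end Coordinates

/-! ### Differential operators on test functions with support in a fixed compact set. -/

section Operators

variable {K : TopologicalSpace.Compacts Alg}

/-- The derivative in the direction `v` of smooth functions supported in `K`. -/
def derivOp (v : Alg) : Module.End ℝ 𝓓_{K}(Alg, ℝ) where
  toFun f := ContDiffMapSupportedIn.of_support_subset (f := fun W => fderiv ℝ f W v)
    ((f.contDiff.fderiv_right (m := ((⊤ : ℕ∞) : WithTop ℕ∞)) le_rfl).clm_apply contDiff_const)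
    (by
      have h : Function.support (fun W => fderiv ℝ f W v) ⊆ Function.support (fderiv ℝ f) :=
        fun W hW h0 => hW (by simp [h0])
      exact h.trans ((support_fderiv_subset ℝ).trans f.tsupport_subset))
  map_add' f g := by
    ext W
    have hf := (f.contDiff.differentiable (by simp)).differentiableAt (x := W)
    have hg := (g.contDiff.differentiable (by simp)).differentiableAt (x := W)
    simp [fderiv_add hf hg]
  map_smul' c f := by
    ext W
    have hf := (f.contDiff.differentiable (by simp)).differentiableAt (x := W)
    simp [fderiv_const_smul hf]

/-- Multiplication by a smooth function. -/
def mulOp (g : Alg → ℝ) (hg : ContDiff ℝ ((⊤ : ℕ∞) : WithTop ℕ∞) g) :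
    Module.End ℝ 𝓓_{K}(Alg, ℝ) where
  toFun f := ContDiffMapSupportedIn.of_support_subset (f := fun W => g W * f W)
    (hg.mul f.contDiff)
    (fun W hW => f.support_subset fun h0 => hW (by simp [h0]))
  map_add' f g' := by
    ext W
    exact mul_add (g W) (f W) (g' W)
  map_smul' c f := by
    ext W
    exact mul_left_comm (g W) c (f W)

@[simp]
theorem derivOp_apply (v : Alg) (f : 𝓓_{K}(Alg, ℝ)) (W : Alg) :
    derivOp v f W = fderiv ℝ f W v := rfl

@[simp]
theorem mulOp_apply (g : Alg → ℝ) (hg : ContDiff ℝ ((⊤ : ℕ∞) : WithTop ℕ∞) g)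
    (f : 𝓓_{K}(Alg, ℝ)) (W : Alg) : mulOp g hg f W = g W * f W := rfl

theorem derivOp_comm (v w : Alg) :
    (derivOp v * derivOp w : Module.End ℝ 𝓓_{K}(Alg, ℝ)) = derivOp w * derivOp v := by
  ext f W
  have hd : ∀ u u' : Alg, derivOp u (derivOp u' f) W = fderiv ℝ (fderiv ℝ f) W u u' := by
    intro u u'
    have h1 : DifferentiableAt ℝ (fderiv ℝ f) W :=
      ((f.contDiff.fderiv_right (m := 1) (by norm_cast)).differentiable (by simp)).differentiableAt
    change fderiv ℝ (fun W => fderiv ℝ f W u') W u = _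
    rw [fderiv_clm_apply h1 (differentiableAt_const _)]
    simp
  rw [Module.End.mul_apply, Module.End.mul_apply, hd, hd]
  have := f.contDiff.contDiffAt (x := W)
  exact (this.isSymmSndFDerivAt (by simpa using (WithTop.coe_le_coe.mpr le_top : ((2 : ℕ∞) : WithTop ℕ∞) ≤ (⊤ : ℕ∞)))) v w

theorem mulOp_comm (g g' : Alg → ℝ) (hg : ContDiff ℝ ((⊤ : ℕ∞) : WithTop ℕ∞) g)
    (hg' : ContDiff ℝ ((⊤ : ℕ∞) : WithTop ℕ∞) g') :
    (mulOp g hg * mulOp g' hg' : Module.End ℝ 𝓓_{K}(Alg, ℝ)) = mulOp g' hg' * mulOp g hg := by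
  ext f W
  simp
  ring

/-- Multiplication by a linear functional. -/
def mulL (l : Alg →L[ℝ] ℝ) : Module.End ℝ 𝓓_{K}(Alg, ℝ) := mulOp l l.contDiff

@[simp]
theorem mulL_apply (l : Alg →L[ℝ] ℝ) (f : 𝓓_{K}(Alg, ℝ)) (W : Alg) :
    mulL l f W = l W * f W := rfl

theorem derivOp_mul_mulL (v : Alg) (l : Alg →L[ℝ] ℝ) :
    (derivOp v * mulL l : Module.End ℝ 𝓓_{K}(Alg, ℝ)) = mulL l * derivOp v + l v • 1 := by
  ext f W
  have hf := (f.contDiff.differentiable (by simp)).differentiableAt (x := W)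
  change fderiv ℝ (fun W => l W * f W) W v = _
  rw [fderiv_fun_mul l.differentiableAt hf]
  simp
  ring

theorem weylRelations : WeylRelations (A := Module.End ℝ 𝓓_{K}(Alg, ℝ)) (mulL coordH)
    (mulL coordX) (mulL coordY) (derivOp H) (derivOp X) (derivOp Y) := by
  constructor
  any_goals exact mulOp_comm _ _ _ _
  any_goals exact derivOp_comm _ _
  all_goals
    rw [derivOp_mul_mulL]
    simp [coordH_apply, coordX_apply, coordY_apply]

variable (K) in
/-- The Casimir operator on functions supported in `K`. -/
def opE : Module.End ℝ 𝓓_{K}(Alg, ℝ) := weylE (derivOp H) (derivOp X) (derivOp Y)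

variable (K) in
/-- Multiplication by `-½ (h² + x y)`. -/
def opF : Module.End ℝ 𝓓_{K}(Alg, ℝ) := weylF (mulL coordH) (mulL coordX) (mulL coordY)

variable (K) in
/-- The shifted Euler operator, which completes `opE` and `opF` to an `sl₂`-triple. -/
def opH : Module.End ℝ 𝓓_{K}(Alg, ℝ) :=
  weylH (mulL coordH) (mulL coordX) (mulL coordY) (derivOp H) (derivOp X) (derivOp Y)

variable (K) in
/-- The vector field `W ↦ -⁅Z, W⁆` on functions supported in `K`. -/
def opLie (Z : Alg) : Module.End ℝ 𝓓_{K}(Alg, ℝ) where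
  toFun f := ContDiffMapSupportedIn.of_support_subset (f := fun W => fderiv ℝ f W (negAd Z W))
    ((f.contDiff.fderiv_right (m := ((⊤ : ℕ∞) : WithTop ℕ∞)) le_rfl).clm_apply
      (negAd Z).contDiff)
    (by
      have h : Function.support (fun W => fderiv ℝ f W (negAd Z W)) ⊆
          Function.support (fderiv ℝ f) := fun W hW h0 => hW (by simp [h0])
      exact h.trans ((support_fderiv_subset ℝ).trans f.tsupport_subset))
  map_add' f g := by
    ext W
    have hf := (f.contDiff.differentiable (by simp)).differentiableAt (x := W)
    have hg := (g.contDiff.differentiable (by simp)).differentiableAt (x := W)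
    simp [fderiv_add hf hg]
  map_smul' c f := by
    ext W
    have hf := (f.contDiff.differentiable (by simp)).differentiableAt (x := W)
    simp [fderiv_const_smul hf]

@[simp]
theorem opLie_apply (Z : Alg) (f : 𝓓_{K}(Alg, ℝ)) (W : Alg) :
    opLie K Z f W = fderiv ℝ f W (negAd Z W) := rfl

theorem opLie_H : opLie K H = weylLH (mulL coordX) (mulL coordY) (derivOp X) (derivOp Y) := by
  ext f W
  simp [weylLH, negAd_H]
  ring

theorem opLie_X : opLie K X = weylLX (mulL coordH) (mulL coordY) (derivOp H) (derivOp X) := by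
  ext f W
  simp [weylLX, negAd_X]
  ring

theorem opLie_Y : opLie K Y = weylLY (mulL coordH) (mulL coordX) (derivOp H) (derivOp Y) := by
  ext f W
  simp [weylLY, negAd_Y]
  ring

theorem opF_apply (f : 𝓓_{K}(Alg, ℝ)) (W : Alg) : opF K f W = (-1 / 2) * quad W * f W := by
  simp [opF, weylF, quad]
  ring

end Operators

/-! ### A power of the quadratic form kills a distribution supported on the cone. -/

section Cutoff

variable {K : TopologicalSpace.Compacts Alg}

theorem mulOp_quad_pow (M : ℕ) (f : 𝓓_{K}(Alg, ℝ)) :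
    mulOp (fun W => quad W ^ M) (contDiff_quad.pow M) f = ((-2 : ℝ) ^ M) • (opF K ^ M) f := by
  ext W
  have h : ((opF K ^ M) f) W = ((-1 / 2) * quad W) ^ M * f W := by
    induction M with
    | zero => simp
    | succ M ih =>
      rw [pow_succ', Module.End.mul_apply, opF_apply, ih]
      ring
  rw [mulOp_apply]
  change _ = (-2 : ℝ) ^ M * ((opF K ^ M) f) W
  rw [h, ← mul_assoc, ← mul_pow]
  congr 2
  ring

/-- By the chain and Leibniz rules each derivative costs at most one factor `T`, uniformly on `K`.
-/
theorem exists_bound_iteratedFDeriv_comp_quad (K : TopologicalSpace.Compacts Alg) (N : ℕ)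
    (η : ℝ → ℝ) (hη : ContDiff ℝ ((⊤ : ℕ∞) : WithTop ℕ∞) η) (hs : HasCompactSupport η)
    (f : 𝓓_{K}(Alg, ℝ)) :
    ∃ B : ℝ, ∀ T : ℝ, 1 ≤ T → ∀ i ≤ N, ∀ W ∈ K,
      ‖iteratedFDeriv ℝ i (fun W => η (T * quad W) * f W) W‖ ≤ B * T ^ N := by
  have hle : ∀ i : ℕ, (i : WithTop ℕ∞) ≤ ((⊤ : ℕ∞) : WithTop ℕ∞) := fun i =>
    WithTop.coe_le_coe.mpr le_top
  have hC : ∃ C : ℝ, 0 ≤ C ∧ ∀ i ≤ N, ∀ t, ‖iteratedFDeriv ℝ i η t‖ ≤ C := by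
    choose C hC using fun i : ℕ => (hη.continuous_iteratedFDeriv (hle i)).bounded_above_of_compact_support
      (hs.iteratedFDeriv i)
    refine ⟨∑ i ∈ Finset.range (N + 1), |C i|, Finset.sum_nonneg fun i _ => abs_nonneg _, ?_⟩
    intro i hi t
    exact ((hC i t).trans (le_abs_self _)).trans (Finset.single_le_sum
      (f := fun i => |C i|) (fun i _ => abs_nonneg _) (Finset.mem_range.mpr (by omega)))
  have hF : ∃ C : ℝ, 0 ≤ C ∧ ∀ i ≤ N, ∀ W, ‖iteratedFDeriv ℝ i f W‖ ≤ C := by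
    choose C hC using fun i : ℕ => f.bounded_iteratedFDeriv (i := i) (by exact_mod_cast le_top)
    refine ⟨∑ i ∈ Finset.range (N + 1), |C i|, Finset.sum_nonneg fun i _ => abs_nonneg _, ?_⟩
    intro i hi t
    exact ((hC i t).trans (le_abs_self _)).trans (Finset.single_le_sum
      (f := fun i => |C i|) (fun i _ => abs_nonneg _) (Finset.mem_range.mpr (by omega)))
  have hQ : ∃ A : ℝ, 1 ≤ A ∧ ∀ i ≤ N, ∀ W ∈ K, ‖iteratedFDeriv ℝ i quad W‖ ≤ A := by
    choose C hC using fun i : ℕ => K.isCompact.exists_bound_of_continuousOn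
      ((contDiff_quad (n := ((⊤ : ℕ∞) : WithTop ℕ∞))).continuous_iteratedFDeriv (hle i)).continuousOn
    refine ⟨1 + ∑ i ∈ Finset.range (N + 1), |C i|,
      le_add_of_nonneg_right (Finset.sum_nonneg fun i _ => abs_nonneg _), ?_⟩
    intro i hi W hW
    refine ((hC i W hW).trans (le_abs_self _)).trans ((Finset.single_le_sum
      (f := fun i => |C i|) (fun i _ => abs_nonneg _) (Finset.mem_range.mpr (by omega))).trans
      (le_add_of_nonneg_left zero_le_one))
  obtain ⟨C, hC0, hC⟩ := hC
  obtain ⟨F, hF0, hF⟩ := hF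
  obtain ⟨A, hA1, hA⟩ := hQ
  refine ⟨2 ^ N * (N.factorial * C * A ^ N) * F, fun T hT i hi W hW => ?_⟩
  -- Both factors are at least `1`, so powers of `T * A` increase with the exponent; this is why `A`
  -- was chosen at least `1`.
  have hTA : 1 ≤ T * A := one_le_mul_of_one_le_of_one_le hT hA1
  have hTq : ContDiff ℝ ((⊤ : ℕ∞) : WithTop ℕ∞) (fun W => T * quad W) :=
    contDiff_const.mul contDiff_quad
  have hcomp : ∀ j ≤ N, ‖iteratedFDeriv ℝ j (fun W => η (T * quad W)) W‖ ≤
      N.factorial * C * A ^ N * T ^ N := by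
    intro j hj
    have h1 := norm_iteratedFDeriv_comp_le hη hTq (hle j) W (C := C) (D := T * A)
      (fun k hk => hC k (hk.trans hj) _) (fun k hk1 hk => by
        have h2 : iteratedFDeriv ℝ k (fun W => T * quad W) W = T • iteratedFDeriv ℝ k quad W :=
          iteratedFDeriv_const_smul_apply (a := T) (f := quad) contDiff_quad.contDiffAt
        rw [h2, norm_smul, Real.norm_of_nonneg (by linarith)]
        calc T * ‖iteratedFDeriv ℝ k quad W‖ ≤ T * A := by
              gcongr
              exact hA k (hk.trans hj) W hW
          _ ≤ (T * A) ^ k := le_self_pow₀ hTA (by omega))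
    refine h1.trans ?_
    rw [mul_assoc _ (A ^ N), ← mul_pow, mul_comm A T]
    gcongr
  refine (norm_iteratedFDeriv_mul_le (hη.comp hTq) f.contDiff W (hle i)).trans ?_
  calc ∑ j ∈ Finset.range (i + 1), (i.choose j : ℝ) *
        ‖iteratedFDeriv ℝ j (fun W => η (T * quad W)) W‖ * ‖iteratedFDeriv ℝ (i - j) f W‖
      ≤ ∑ j ∈ Finset.range (i + 1), (i.choose j : ℝ) * (N.factorial * C * A ^ N * T ^ N) * F := by
        gcongr with j hj
        · exact hcomp j (by have := Finset.mem_range.mp hj; omega)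
        · exact hF _ (by omega) W
    _ = 2 ^ i * (N.factorial * C * A ^ N * T ^ N) * F := by
        rw [← Finset.sum_mul, ← Finset.sum_mul, ← Nat.cast_sum, Nat.sum_range_choose]
        push_cast
        rfl
    _ ≤ 2 ^ N * (N.factorial * C * A ^ N * T ^ N) * F := by
        gcongr
        norm_num
    _ = _ := by ring

/-- On a fixed compact set `ψ` has some finite order `N`. Cutting `quad ^ (N + 1) * f` off to
`|quad| ≲ 1 / T` does not change its value under `ψ`, and the cut-off function has derivatives up to
order `N` of size `O(1 / T)`. -/
theorem exists_comp_opF_pow_eq_zero {V : Type*} [NormedAddCommGroup V] [NormedSpace ℝ V]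
    (ψ : 𝓓_{K}(Alg, ℝ) →L[ℝ] V)
    (hψ : ∀ f : 𝓓_{K}(Alg, ℝ), (∀ W ∈ tsupport f, quad W ≠ 0) → ψ f = 0) :
    ∃ M : ℕ, ∀ f, ψ ((opF K ^ M) f) = 0 := by
  obtain ⟨s, C, -, hsC⟩ := Seminorm.bound_of_continuous
    (ContDiffMapSupportedIn.withSeminorms ℝ Alg ℝ ⊤ K)
    ((normSeminorm ℝ V).comp ψ.toLinearMap) (continuous_norm.comp ψ.continuous)
  set N := s.sup id
  refine ⟨N + 1, fun f => ?_⟩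
  let χ : ContDiffBump (0 : ℝ) := ⟨1, 2, one_pos, one_lt_two⟩
  -- The exponent exceeds the order by one: rescaling gains `T ^ (-(N + 1))` and differentiation
  -- loses only `T ^ N`.
  set η : ℝ → ℝ := fun t => t ^ (N + 1) * χ t
  have hη : ContDiff ℝ ((⊤ : ℕ∞) : WithTop ℕ∞) η := (contDiff_id.pow _).mul χ.contDiff
  have hηs : HasCompactSupport η := χ.hasCompactSupport.mul_left
  obtain ⟨B, hB⟩ := exists_bound_iteratedFDeriv_comp_quad K N η hη hηs f
  have hTq : ∀ T : ℝ, ContDiff ℝ ((⊤ : ℕ∞) : WithTop ℕ∞) (fun W => T * quad W) := fun T =>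
    contDiff_const.mul contDiff_quad
  set q := mulOp (fun W => quad W ^ (N + 1)) (contDiff_quad.pow (N + 1)) f with hq
  suffices hq0 : ψ q = 0 by
    rw [hq, mulOp_quad_pow, map_smul] at hq0
    exact (smul_eq_zero.mp hq0).resolve_left (by positivity)
  have key : ∀ T : ℝ, 1 ≤ T → ‖ψ q‖ ≤ C * |B| / T := by
    intro T hT
    have hT0 : 0 < T := by linarith
    set g := mulOp (fun W => η (T * quad W)) (hη.comp (hTq T)) f with hg
    have h1 : ψ q = (T ^ (N + 1))⁻¹ • ψ g := by
      rw [← map_smul, ← sub_eq_zero, ← map_sub]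
      apply hψ
      intro W hW
      have hval : ∀ W, (q - (T ^ (N + 1))⁻¹ • g) W
          = quad W ^ (N + 1) * (1 - χ (T * quad W)) * f W := by
        intro W
        change quad W ^ (N + 1) * f W -
          (T ^ (N + 1))⁻¹ * ((T * quad W) ^ (N + 1) * χ (T * quad W) * f W) = _
        rw [mul_pow]
        field_simp
      have hcl : IsClosed {W : Alg | 1 ≤ |T * quad W|} :=
        isClosed_le continuous_const (hTq T).continuous.abs
      have hsub : tsupport (q - (T ^ (N + 1))⁻¹ • g) ⊆ {W : Alg | 1 ≤ |T * quad W|} := by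
        refine closure_minimal (fun W hW => ?_) hcl
        by_contra hlt
        refine hW ?_
        rw [hval, χ.one_of_mem_closedBall, sub_self, mul_zero, zero_mul]
        rw [mem_closedBall_zero_iff]
        exact (not_le.mp hlt).le
      intro h0
      have := hsub hW
      simp only [Set.mem_ofPred_eq, h0, mul_zero, abs_zero] at this
      linarith
    have h2 : ‖ψ g‖ ≤ C * (|B| * T ^ N) := by
      refine (hsC g).trans ?_
      rw [smul_apply, NNReal.smul_def, smul_eq_mul]
      gcongr
      refine Seminorm.finset_sup_apply_le (by positivity) fun i hi => ?_
      rw [ContDiffMapSupportedIn.seminorm_top_le_iff ℝ (by positivity)]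
      intro W hW
      refine (hB T hT i (Finset.le_sup (f := id) hi) W hW).trans ?_
      gcongr
      exact le_abs_self B
    rw [h1, norm_smul, norm_inv, norm_pow, Real.norm_of_nonneg hT0.le]
    calc (T ^ (N + 1))⁻¹ * ‖ψ g‖ ≤ (T ^ (N + 1))⁻¹ * (C * (|B| * T ^ N)) := by gcongr
      _ = C * |B| / T := by
        field_simp
        ring
  have hlim : Filter.Tendsto (fun T : ℝ => (C : ℝ) * |B| / T) Filter.atTop (nhds 0) :=
    Filter.Tendsto.const_div_atTop Filter.tendsto_id _
  have h0 := ge_of_tendsto hlim (Filter.eventually_atTop.mpr ⟨1, key⟩)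
  exact norm_le_zero_iff.mp h0

end Cutoff

/-! ### Smoothness of integrals depending on a parameter. -/

section ParametricIntegral

variable {E G : Type} [NormedAddCommGroup E] [NormedSpace ℝ E] [ProperSpace E]
  [NormedAddCommGroup G] [NormedSpace ℝ G]

theorem hasFDerivAt_intervalIntegral_of_contDiff {F : E × ℝ → G} (hF : ContDiff ℝ 1 F) (a b : ℝ)
    (x : E) : HasFDerivAt (fun x => ∫ t in a..b, F (x, t))
      (∫ t in a..b, (fderiv ℝ F (x, t)).comp (ContinuousLinearMap.inl ℝ E ℝ)) x := by
  have hcont : Continuous fun p : E × ℝ => (fderiv ℝ F p).comp (ContinuousLinearMap.inl ℝ E ℝ) :=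
    (hF.continuous_fderiv (by simp)).clm_comp continuous_const
  obtain ⟨C, hC⟩ := ((isCompact_closedBall x 1).prod (isCompact_uIcc (a := a) (b := b))).exists_bound_of_continuousOn
    hcont.continuousOn
  refine intervalIntegral.hasFDerivAt_integral_of_dominated_of_fderiv_le
    (F' := fun x t => (fderiv ℝ F (x, t)).comp (ContinuousLinearMap.inl ℝ E ℝ))
    (bound := fun _ => C) (Metric.closedBall_mem_nhds x one_pos) ?_ ?_ ?_ ?_ ?_ ?_
  · exact Filter.Eventually.of_forall fun y =>
      (hF.continuous.comp (by fun_prop : Continuous fun t : ℝ => (y, t))).aestronglyMeasurable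
  · exact (hF.continuous.comp (by fun_prop : Continuous fun t : ℝ => (x, t))).intervalIntegrable _ _
  · exact (hcont.comp (by fun_prop : Continuous fun t : ℝ => (x, t))).aestronglyMeasurable
  · exact Filter.Eventually.of_forall fun t ht y hy =>
      hC (y, t) ⟨hy, Set.uIoc_subset_uIcc ht⟩
  · exact intervalIntegrable_const
  · refine Filter.Eventually.of_forall fun t _ y _ => ?_
    have h1 := (hF.differentiable (by simp) (y, t)).hasFDerivAt
    exact h1.comp y (hasFDerivAt_prodMk_left y t)

/-- The derivative is an integral of the same kind with values in a space of linear maps, so the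
induction must let `G` vary. -/
theorem contDiff_intervalIntegral {F : E × ℝ → G} (hF : ContDiff ℝ ((⊤ : ℕ∞) : WithTop ℕ∞) F)
    (a b : ℝ) : ContDiff ℝ ((⊤ : ℕ∞) : WithTop ℕ∞) fun x => ∫ t in a..b, F (x, t) := by
  rw [contDiff_infty]
  intro n
  induction n generalizing G with
  | zero =>
    have h := fun x => (hasFDerivAt_intervalIntegral_of_contDiff
      (hF.of_le (by exact_mod_cast le_top)) a b x).continuousAt
    exact contDiff_zero.mpr (continuous_iff_continuousAt.mpr h)
  | succ n ih =>
    rw [Nat.cast_succ, contDiff_succ_iff_hasFDerivAt]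
    refine ⟨_, ?_, fun x => hasFDerivAt_intervalIntegral_of_contDiff
      (hF.of_le (by exact_mod_cast le_top)) a b x⟩
    exact ih ((hF.fderiv_right (m := ((⊤ : ℕ∞) : WithTop ℕ∞)) le_rfl).clm_comp contDiff_const)

end ParametricIntegral

/-! ### The adjoint action of the rotation group. -/

section Rotation

/-- Half the adjoint action of `X - Y`. -/
def rotGen : Alg →L[ℝ] Alg := (-1 / 2 : ℝ) • (negAd X - negAd Y)

theorem rotGen_apply (W : Alg) :
    rotGen W = ((coordX W + coordY W) / 2) • H - coordH W • X - coordH W • Y := by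
  change (-1 / 2 : ℝ) • (negAd X W - negAd Y W) = _
  rw [negAd_X, negAd_Y]
  module

/-- This relation reduces the exponential of `2 s • rotGen` to the closed form used for `rot`. -/
theorem rotGen_rotGen_rotGen (W : Alg) : rotGen (rotGen (rotGen W)) = -rotGen W := by
  apply ext_coord <;> simp [rotGen_apply, coordH_apply, coordX_apply, coordY_apply]

/-- The adjoint action of the rotation by the angle `s`. -/
def rot (s : ℝ) : Alg →L[ℝ] Alg :=
  ContinuousLinearMap.id ℝ Alg + Real.sin (2 * s) • rotGen +
    (1 - Real.cos (2 * s)) • (rotGen ∘L rotGen)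

theorem rot_apply (s : ℝ) (W : Alg) :
    rot s W = W + Real.sin (2 * s) • rotGen W + (1 - Real.cos (2 * s)) • rotGen (rotGen W) := rfl

theorem contDiff_rot {n : WithTop ℕ∞} : ContDiff ℝ n rot := by
  unfold rot
  fun_prop

theorem rot_zero (W : Alg) : rot 0 W = W := by simp [rot_apply]

/-- The period is `π` and not `2π` since `-1 ∈ SL(2, ℝ)` acts trivially; the parity obstruction
rests on this. -/
theorem rot_pi (W : Alg) : rot Real.pi W = W := by simp [rot_apply]

theorem rot_add (s t : ℝ) (W : Alg) : rot (s + t) W = rot s (rot t W) := by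
  simp only [rot_apply, map_add, map_smul, rotGen_rotGen_rotGen, map_neg, mul_add, Real.sin_add,
    Real.cos_add]
  module

theorem rot_rotGen (s : ℝ) (W : Alg) : rot s (rotGen W) = rotGen (rot s W) := by
  simp [rot_apply]

theorem rot_periodic : Function.Periodic rot Real.pi := by
  intro s
  ext1 W
  rw [rot_add, rot_pi]

theorem hasDerivAt_rot (s : ℝ) (W : Alg) :
    HasDerivAt (fun s => rot s W) ((2 : ℝ) • rotGen (rot s W)) s := by
  have h2 : HasDerivAt (fun s : ℝ => 2 * s) 2 s := by
    simpa using (hasDerivAt_id s).const_mul (2 : ℝ)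
  have hs := (h2.sin.smul_const (rotGen W)).const_add W
  have hc := (h2.cos.const_sub 1).smul_const (rotGen (rotGen W))
  refine (hs.add hc).congr_deriv ?_
  simp only [rot_apply, map_add, map_smul, rotGen_rotGen_rotGen]
  module

/-- The rotation by the angle `s` as an element of `SL(2, ℝ)`. -/
def rotMatrix (s : ℝ) : Matrix.SpecialLinearGroup (Fin 2) ℝ :=
  ⟨!![Real.cos s, Real.sin s; -Real.sin s, Real.cos s], by
    rw [Matrix.det_fin_two_of]
    linear_combination Real.sin_sq_add_cos_sq s⟩

theorem coe_inv_rotMatrix (s : ℝ) :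
    ((rotMatrix s)⁻¹ : Matrix.SpecialLinearGroup (Fin 2) ℝ).val =
      !![Real.cos s, -Real.sin s; Real.sin s, Real.cos s] := by
  rw [Matrix.SpecialLinearGroup.coe_inv, rotMatrix, Matrix.adjugate_fin_two_of, neg_neg]

theorem toMatrix_Ad_rotMatrix (s : ℝ) (W : Alg) : toMatrix (Ad (rotMatrix s) W) =
    !![Real.cos s, Real.sin s; -Real.sin s, Real.cos s] *
      !![toMatrix W 0 0, toMatrix W 0 1; toMatrix W 1 0, -toMatrix W 0 0] *
      !![Real.cos s, -Real.sin s; Real.sin s, Real.cos s] := by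
  rw [← coe_inv_rotMatrix, ← toMatrix_one_one, ← Matrix.eta_fin_two (toMatrix W)]
  rfl

theorem rot_eq_Ad (s : ℝ) (W : Alg) : rot s W = Ad (rotMatrix s) W := by
  have hcs := Real.sin_sq_add_cos_sq s
  apply ext_coord <;>
    simp [rot_apply, rotGen_apply, coordH_apply, coordX_apply, coordY_apply,
      toMatrix_Ad_rotMatrix, Real.sin_two_mul, Real.cos_two_mul]
  · linear_combination (toMatrix W 0 0) * hcs
  · linear_combination (toMatrix W 1 0) * hcs
  · linear_combination (toMatrix W 0 1) * hcs

theorem rot_mem {s : Set Alg} (hs : IsInvariantSet s) (t : ℝ) {W : Alg} (hW : W ∈ s) :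
    rot t W ∈ s := by
  rw [rot_eq_Ad]
  exact hs _ _ hW

/-- Sweeping `S` by the angles in `[0, π]` gives a compact set, stable by periodicity. Averages over
rotations then keep supports inside it. -/
theorem exists_rot_invariant_compact {U : Set Alg} (hU : IsInvariantSet U) {S : Set Alg}
    (hS : IsCompact S) (hSU : S ⊆ U) :
    ∃ K : TopologicalSpace.Compacts Alg, S ⊆ K ∧ (K : Set Alg) ⊆ U ∧
      ∀ s, ∀ W ∈ K, rot s W ∈ K := by
  have hc : Continuous fun p : ℝ × Alg => rot p.1 p.2 :=
    ((contDiff_rot (n := 0)).continuous.comp continuous_fst).clm_apply continuous_snd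
  refine ⟨⟨(fun p : ℝ × Alg => rot p.1 p.2) '' (Set.Icc 0 Real.pi ×ˢ S),
    (isCompact_Icc.prod hS).image hc⟩, ?_, ?_, ?_⟩
  · intro W hW
    exact ⟨(0, W), ⟨⟨le_rfl, Real.pi_pos.le⟩, hW⟩, rot_zero W⟩
  · rintro _ ⟨⟨t, W⟩, ⟨-, hW⟩, rfl⟩
    exact rot_mem hU t (hSU hW)
  · rintro s _ ⟨⟨t, W⟩, ⟨-, hW⟩, rfl⟩
    obtain ⟨r, hr, hrs⟩ := rot_periodic.exists_mem_Ico₀ Real.pi_pos (s + t)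
    refine ⟨(r, W), ⟨⟨hr.1, hr.2.le⟩, hW⟩, ?_⟩
    change rot r W = rot s (rot t W)
    rw [← rot_add, hrs]

end Rotation

/-! ### Inverting `(X - Y)² + m²` on test functions for odd `m`. -/

section Averaging

variable {K : TopologicalSpace.Compacts Alg}

/-- The operator `f ↦ ∫₀^π sin (m s) f (rot s W) ds`. -/
def rotAverage (hK : ∀ s, ∀ W ∈ K, rot s W ∈ K) (m : ℝ) (f : 𝓓_{K}(Alg, ℝ)) : 𝓓_{K}(Alg, ℝ) :=
  ContDiffMapSupportedIn.of_support_subset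
    (f := fun W => ∫ s in (0 : ℝ)..Real.pi, Real.sin (m * s) * f (rot s W))
    (contDiff_intervalIntegral (F := fun p : Alg × ℝ => Real.sin (m * p.2) * f (rot p.2 p.1))
      ((by fun_prop : ContDiff ℝ ((⊤ : ℕ∞) : WithTop ℕ∞) fun p : Alg × ℝ =>
        Real.sin (m * p.2)).mul
        (f.contDiff.comp ((contDiff_rot.comp contDiff_snd).clm_apply contDiff_fst))) 0 Real.pi)
    (by
      intro W hW
      by_contra hWK
      refine hW ?_
      have h0 : ∀ s, f (rot s W) = 0 := by
        intro s
        refine f.zero_on_compl fun hs => hWK ?_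
        have := hK (-s) _ hs
        rwa [← rot_add, neg_add_cancel, rot_zero] at this
      simp [h0])

theorem rotAverage_apply (hK : ∀ s, ∀ W ∈ K, rot s W ∈ K) (m : ℝ) (f : 𝓓_{K}(Alg, ℝ)) (W : Alg) :
    rotAverage hK m f W = ∫ s in (0 : ℝ)..Real.pi, Real.sin (m * s) * f (rot s W) := rfl

theorem opLie_X_sub_opLie_Y_apply (f : 𝓓_{K}(Alg, ℝ)) (W : Alg) :
    (opLie K X - opLie K Y) f W = fderiv ℝ f W ((-2 : ℝ) • rotGen W) := by
  change fderiv ℝ f W (negAd X W) - fderiv ℝ f W (negAd Y W) = _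
  rw [← map_sub]
  congr 1
  change _ = (-2 : ℝ) • (-1 / 2 : ℝ) • (negAd X W - negAd Y W)
  module

theorem hasDerivAt_comp_rot (f : 𝓓_{K}(Alg, ℝ)) (W : Alg) (s : ℝ) :
    HasDerivAt (fun s => f (rot s W)) (-(opLie K X - opLie K Y) f (rot s W)) s := by
  have hf := (f.contDiff.differentiable (by simp) (rot s W)).hasFDerivAt
  refine (hf.comp_hasDerivAt s (hasDerivAt_rot s W)).congr_deriv ?_
  rw [opLie_X_sub_opLie_Y_apply, ← map_neg]
  congr 1
  module

theorem opLie_rotAverage (hK : ∀ s, ∀ W ∈ K, rot s W ∈ K) (m : ℝ) (f : 𝓓_{K}(Alg, ℝ)) :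
    (opLie K X - opLie K Y) (rotAverage hK m f) =
      rotAverage hK m ((opLie K X - opLie K Y) f) := by
  ext W
  rw [opLie_X_sub_opLie_Y_apply]
  set F : Alg × ℝ → ℝ := fun p => Real.sin (m * p.2) * f (rot p.2 p.1) with hFdef
  have hF : ContDiff ℝ 1 F := (by fun_prop : ContDiff ℝ 1 fun p : Alg × ℝ =>
        Real.sin (m * p.2)).mul ((f.contDiff.of_le (by exact_mod_cast le_top)).comp
          ((contDiff_rot.comp contDiff_snd).clm_apply contDiff_fst))
  have h1 := hasFDerivAt_intervalIntegral_of_contDiff hF 0 Real.pi W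
  change fderiv ℝ (fun W => ∫ s in (0 : ℝ)..Real.pi, F (W, s)) W _ = _
  have hint : IntervalIntegrable (fun s => (fderiv ℝ F (W, s)).comp (ContinuousLinearMap.inl ℝ Alg ℝ))
      MeasureTheory.volume 0 Real.pi :=
    (((hF.continuous_fderiv (by simp)).comp
      (by fun_prop : Continuous fun s : ℝ => (W, s))).clm_comp continuous_const).intervalIntegrable _ _
  rw [h1.fderiv, ContinuousLinearMap.intervalIntegral_apply hint, rotAverage_apply]
  refine intervalIntegral.integral_congr fun s _ => ?_
  have h2 : HasFDerivAt (fun W => F (W, s))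
      ((fderiv ℝ F (W, s)).comp (ContinuousLinearMap.inl ℝ Alg ℝ)) W :=
    HasFDerivAt.comp (g := F) (f := fun W => (W, s)) W
      (hF.differentiable (by simp) (W, s)).hasFDerivAt (hasFDerivAt_prodMk_left W s)
  have hf := (f.contDiff.differentiable (by simp) (rot s W)).hasFDerivAt
  have h3 : HasFDerivAt (fun W => F (W, s)) _ W :=
    (hf.comp W (rot s).hasFDerivAt).const_mul (Real.sin (m * s))
  change (((fderiv ℝ F (W, s)).comp (ContinuousLinearMap.inl ℝ Alg ℝ)) _) = _
  rw [h2.unique h3, opLie_X_sub_opLie_Y_apply]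
  simp [rot_rotGen]

/-- Along a rotation orbit `X - Y` acts as `-d/ds`, so integrating twice by parts against `sin (m
s)` leaves boundary terms only. -/
theorem rotAverage_opLie (hK : ∀ s, ∀ W ∈ K, rot s W ∈ K) (m : ℤ) (hm : Odd m)
    (f : 𝓓_{K}(Alg, ℝ)) :
    rotAverage hK m ((opLie K X - opLie K Y) ((opLie K X - opLie K Y) f)) +
      ((m : ℝ) ^ 2) • rotAverage hK m f = (2 * m : ℝ) • f := by
  ext W
  set R := opLie K X - opLie K Y
  change (∫ s in (0 : ℝ)..Real.pi, Real.sin (m * s) * R (R f) (rot s W)) +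
    (m : ℝ) ^ 2 * (∫ s in (0 : ℝ)..Real.pi, Real.sin (m * s) * f (rot s W)) = 2 * m * f W
  have hrot : Continuous fun s : ℝ => rot s W := (contDiff_rot (n := 0)).continuous.clm_apply continuous_const
  have hc : ∀ g : 𝓓_{K}(Alg, ℝ), Continuous fun s : ℝ => Real.sin (m * s) * g (rot s W) := fun g =>
    (by fun_prop : Continuous fun s : ℝ => Real.sin (m * s)).mul (g.continuous.comp hrot)
  rw [← intervalIntegral.integral_const_mul, ← intervalIntegral.integral_add
    ((hc _).intervalIntegrable _ _) (((hc _).const_mul _).intervalIntegrable _ _)]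
  have hder : ∀ s : ℝ, HasDerivAt
      (fun s => -(Real.sin (m * s) * R f (rot s W) + m * Real.cos (m * s) * f (rot s W)))
      (Real.sin (m * s) * R (R f) (rot s W) + (m : ℝ) ^ 2 * (Real.sin (m * s) * f (rot s W))) s := by
    intro s
    have hms : HasDerivAt (fun s : ℝ => m * s) m s := by
      simpa using (hasDerivAt_id s).const_mul (m : ℝ)
    refine ((hms.sin.mul (hasDerivAt_comp_rot (R f) W s)).add
      ((hms.cos.const_mul (m : ℝ)).mul (hasDerivAt_comp_rot f W s))).neg.congr_deriv ?_
    change -(_ * R f _ + _ * -(R (R f) _) + (_ * f _ + _ * -(R f _))) = _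
    ring
  rw [intervalIntegral.integral_eq_sub_of_hasDerivAt (fun s _ => hder s)
    (((hc _).add ((hc _).const_mul _)).intervalIntegrable _ _)]
  -- Oddness of `m` makes the boundary terms at `0` and `π` add up to `2 m f`; for even `m` they
  -- would cancel.
  have hcos : Real.cos (m * Real.pi) = -1 := by
    rw [Real.cos_int_mul_pi, hm.neg_one_zpow]
  simp only [Real.sin_int_mul_pi, hcos, rot_pi, rot_zero, mul_zero, Real.sin_zero, Real.cos_zero]
  ring

theorem surjective_opLie_sq_add (hK : ∀ s, ∀ W ∈ K, rot s W ∈ K) (m : ℤ) (hm : Odd m) :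
    Function.Surjective ((opLie K X - opLie K Y) * (opLie K X - opLie K Y) +
      ((m : ℝ) ^ 2) • (1 : Module.End ℝ 𝓓_{K}(Alg, ℝ))) := by
  intro f
  have hm0 : (2 * m : ℝ) ≠ 0 := by
    have : m ≠ 0 := by
      rintro rfl
      exact absurd hm (by decide)
    positivity
  refine ⟨(2 * m : ℝ)⁻¹ • rotAverage hK m f, ?_⟩
  rw [map_smul, LinearMap.add_apply, Module.End.mul_apply, opLie_rotAverage, opLie_rotAverage,
    LinearMap.smul_apply, Module.End.one_apply, rotAverage_opLie hK m hm, smul_smul,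
    inv_mul_cancel₀ hm0, one_smul]

end Averaging

/-! ### Transfer to distributions and conclusion. -/

section Main

theorem lie_lie_eq {L M : Type*} [LieRing L] [AddCommGroup M] [LieRingModule L M] {a b c : L}
    (h : ⁅a, b⁆ = c) (v : M) : ⁅a, ⁅b, v⁆⁆ = ⁅b, ⁅a, v⁆⁆ + ⁅c, v⁆ := by
  rw [leibniz_lie, h, add_comm]

variable {K : TopologicalSpace.Compacts Alg} {U : TopologicalSpace.Opens Alg}
  {V : Type*} [NormedAddCommGroup V] [NormedSpace ℝ V]

/-- The restriction of a distribution to the functions supported in `K`. -/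
def restrictToCompact (hKU : (K : Set Alg) ⊆ U) (φ : 𝓓'(U, V)) : 𝓓_{K}(Alg, ℝ) →L[ℝ] V :=
  ContinuousLinearMap.comp (show 𝓓(U, ℝ) →L[ℝ] V from φ) (TestFunction.ofSupportedInCLM ℝ hKU)

theorem restrictToCompact_apply (hKU : (K : Set Alg) ⊆ U) (φ : 𝓓'(U, V)) (f : 𝓓_{K}(Alg, ℝ)) :
    restrictToCompact hKU φ f = φ (TestFunction.ofSupportedIn hKU f) := rfl

theorem lineDerivOp_ofSupportedIn (hKU : (K : Set Alg) ⊆ U) (v : Alg) (f : 𝓓_{K}(Alg, ℝ)) :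
    ∂_{v} (TestFunction.ofSupportedIn hKU f) = TestFunction.ofSupportedIn hKU (derivOp v f) := by
  ext W
  have hf := (f.contDiff.differentiable (by simp) W)
  rw [TestFunction.lineDerivOp_eq_lineDerivCLM (𝕜 := ℝ), TestFunction.lineDerivCLM_apply]
  simp [hf.lineDeriv_eq_fderiv]

theorem lieDerivTest_ofSupportedIn (hKU : (K : Set Alg) ⊆ U) (Z : Alg) (f : 𝓓_{K}(Alg, ℝ)) :
    lieDerivTest Z (TestFunction.ofSupportedIn hKU f) =
      TestFunction.ofSupportedIn hKU (opLie K Z f) := rfl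

/-- The Casimir operator has order two and constant coefficients, so it is its own transpose. -/
theorem restrictToCompact_casimir (hKU : (K : Set Alg) ⊆ U) (φ : 𝓓'(U, V))
    (f : 𝓓_{K}(Alg, ℝ)) :
    restrictToCompact hKU (casimir φ) f = restrictToCompact hKU φ (opE K f) := by
  rw [restrictToCompact_apply, casimir_apply, lineDerivOp_ofSupportedIn, lineDerivOp_ofSupportedIn,
    lineDerivOp_ofSupportedIn, lineDerivOp_ofSupportedIn]
  simp only [← restrictToCompact_apply, opE, weylE, LinearMap.add_apply, LinearMap.smul_apply,
    Module.End.mul_apply, map_add, map_smul]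

theorem restrictToCompact_casimir_pow (hKU : (K : Set Alg) ⊆ U) (φ : 𝓓'(U, V)) (k : ℕ)
    (f : 𝓓_{K}(Alg, ℝ)) :
    restrictToCompact hKU ((casimir ^ k) φ) f = restrictToCompact hKU φ ((opE K ^ k) f) := by
  induction k generalizing f with
  | zero => rfl
  | succ k ih =>
    rw [pow_succ', Module.End.mul_apply, restrictToCompact_casimir, ih, pow_succ,
      Module.End.mul_apply]

/-- Otherwise evaluation at `□` would embed the infinite dimensional space of polynomials into `ℝ[□]
φ`. -/
theorem exists_aeval_casimir_eq_zero {φ : 𝓓'(U, V)} (hfin : IsCasimirFinite φ) :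
    ∃ p : Polynomial ℝ, p ≠ 0 ∧ Polynomial.aeval (casimir (U := U) (V := V)) p φ = 0 := by
  by_contra! hne
  let S := Submodule.span ℝ (Set.range fun k : ℕ => (casimir ^ k) φ)
  let T : Polynomial ℝ →ₗ[ℝ] 𝓓'(U, V) :=
    LinearMap.applyₗ φ ∘ₗ (Polynomial.aeval (casimir (U := U) (V := V))).toLinearMap
  have hT : ∀ p, T p = Polynomial.aeval (casimir (U := U) (V := V)) p φ := fun p => rfl
  have hTS : ∀ p, T p ∈ S := by
    intro p
    rw [hT, Polynomial.aeval_eq_sum_range, LinearMap.sum_apply]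
    exact S.sum_mem fun k _ => S.smul_mem _ (Submodule.subset_span ⟨k, rfl⟩)
  have hinj : Function.Injective (T.codRestrict S hTS) := by
    rw [← LinearMap.ker_eq_bot, LinearMap.ker_codRestrict, LinearMap.ker_eq_bot']
    intro p hp
    by_contra hp0
    exact hne p hp0 hp
  have : FiniteDimensional ℝ S := hfin
  exact Polynomial.not_finite (R := ℝ) (Module.Finite.of_injective _ hinj)

theorem exists_comp_aeval_opE_eq_zero (hKU : (K : Set Alg) ⊆ U) {φ : 𝓓'(U, V)}
    (hfin : IsCasimirFinite φ) : ∃ p : Polynomial ℝ, p ≠ 0 ∧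
      (restrictToCompact hKU φ).toLinearMap ∘ₗ Polynomial.aeval (opE K) p = 0 := by
  obtain ⟨p, hp, hpφ⟩ := exists_aeval_casimir_eq_zero hfin
  refine ⟨p, hp, ?_⟩
  ext f
  have h : ∀ q : Polynomial ℝ,
      restrictToCompact hKU (Polynomial.aeval (casimir (U := U) (V := V)) q φ) f =
        restrictToCompact hKU φ (Polynomial.aeval (opE K) q f) := by
    intro q
    induction q using Polynomial.induction_on' with
    | add q r hq hr =>
      rw [map_add, map_add, LinearMap.add_apply, LinearMap.add_apply, map_add, ← hq, ← hr]
      rfl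
    | monomial k a =>
      rw [Polynomial.aeval_monomial, Polynomial.aeval_monomial, ← Algebra.smul_def,
        ← Algebra.smul_def, LinearMap.smul_apply, LinearMap.smul_apply, map_smul,
        ← restrictToCompact_casimir_pow]
      rfl
  have h0 := h p
  rw [hpφ] at h0
  exact h0.symm

variable [LieRingModule Alg V] [LieModule ℝ Alg V]

variable (K V) in
/-- The linear maps on functions supported in `K` which intertwine the action of `sl(2, ℝ)`. -/
def equivariantMaps : Submodule ℝ (𝓓_{K}(Alg, ℝ) →ₗ[ℝ] V) where
  carrier := {ψ | ∀ Z ∈ ({H, X, Y} : Set Alg), ∀ f, ⁅Z, ψ f⁆ = ψ (opLie K Z f)}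
  add_mem' {ψ χ} hψ hχ Z hZ f := by
    simp [hψ Z hZ f, hχ Z hZ f]
  zero_mem' Z _ f := by simp
  smul_mem' c ψ hψ Z hZ f := by simp [hψ Z hZ f]

theorem comp_mem_equivariantMaps {ψ : 𝓓_{K}(Alg, ℝ) →ₗ[ℝ] V} (hψ : ψ ∈ equivariantMaps K V)
    {T : Module.End ℝ 𝓓_{K}(Alg, ℝ)} (hH : opLie K H * T = T * opLie K H)
    (hX : opLie K X * T = T * opLie K X) (hY : opLie K Y * T = T * opLie K Y) :
    ψ ∘ₗ T ∈ equivariantMaps K V := by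
  have hT : ∀ Z ∈ ({H, X, Y} : Set Alg), opLie K Z * T = T * opLie K Z := by
    rintro Z (rfl | rfl | rfl) <;> assumption
  intro Z hZ f
  rw [LinearMap.comp_apply, hψ Z hZ, LinearMap.comp_apply]
  exact congrArg ψ (LinearMap.congr_fun (hT Z hZ) f)

variable [FiniteDimensional ℝ V]

/-- The sign in the transpose of `ℒ_Z` turns local invariance into an intertwining property. -/
theorem restrictToCompact_mem_equivariantMaps (hKU : (K : Set Alg) ⊆ U) {φ : 𝓓'(U, V)}
    (hinv : IsLocallyInvariant φ) :
    (restrictToCompact hKU φ).toLinearMap ∈ equivariantMaps K V := by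
  intro Z _ f
  have h := lieAction_apply Z φ (TestFunction.ofSupportedIn hKU f)
  rw [hinv Z, lieDerivTest_ofSupportedIn] at h
  exact sub_eq_zero.mp h.symm

theorem eq_zero_of_mem_equivariantMaps (hK : ∀ s, ∀ W ∈ K, rot s W ∈ K)
    {ψ : 𝓓_{K}(Alg, ℝ) →ₗ[ℝ] V} (hψ : ψ ∈ equivariantMaps K V) (hf : ψ ∘ₗ opF K = 0) (j : ℕ)
    (hj : ψ ∘ₗ (opH K - (j : ℝ) • 1) = 0) : ψ = 0 := by
  refine eq_zero_of_comp_sub_natCast_eq_zero (a := LieModule.toEnd ℝ Alg V H)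
    (b := LieModule.toEnd ℝ Alg V X) (c := LieModule.toEnd ℝ Alg V Y)
    (A := opLie K H) (B := opLie K X) (C := opLie K Y) (e := opE K) (f := opF K) (h := opH K)
    ?_ ?_ ?_ ?_ (surjective_opLie_sq_add hK) ψ (hψ H (by simp)) (hψ X (by simp)) (hψ Y (by simp))
    hf j hj
  · ext v
    simpa using lie_lie_eq lie_H_X v
  · ext v
    simpa [sub_eq_add_neg] using lie_lie_eq lie_H_Y v
  · ext v
    simpa using lie_lie_eq lie_X_Y v
  · rw [opLie_H, opLie_X, opLie_Y]
    exact weylRelations.casimir_eq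

theorem restrictToCompact_eq_zero (hKU : (K : Set Alg) ⊆ U)
    (hK : ∀ s, ∀ W ∈ K, rot s W ∈ K) {φ : 𝓓'(U, V)} (hinv : IsLocallyInvariant φ)
    (hvan : Distribution.IsVanishingOn φ ((U : Set Alg) \ nilpotentCone))
    (hfin : IsCasimirFinite φ) : restrictToCompact hKU φ = 0 := by
  obtain ⟨N, hN⟩ := exists_comp_opF_pow_eq_zero (restrictToCompact hKU φ) fun f hf =>
    hvan (TestFunction.ofSupportedIn hKU f) fun W hW =>
      ⟨hKU (f.tsupport_subset hW), fun hn => hf W hW (quad_eq_zero_of_mem_nilpotentCone hn)⟩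
  obtain ⟨p, hp, hpφ⟩ := exists_comp_aeval_opE_eq_zero hKU hfin
  have r := weylRelations (K := K)
  have h0 := eq_zero_of_comp_aeval_eq_zero_of_comp_pow_eq_zero (e := opE K) (f := opF K)
    (h := opH K) r.weylH_mul_weylE r.weylE_mul_weylF r.weylH_mul_weylF (equivariantMaps K V)
    (fun ψ hψ => comp_mem_equivariantMaps hψ (by rw [opLie_H]; exact r.weylLH_mul_weylH)
      (by rw [opLie_X]; exact r.weylLX_mul_weylH) (by rw [opLie_Y]; exact r.weylLY_mul_weylH))
    (fun ψ hψ => comp_mem_equivariantMaps hψ (by rw [opLie_H]; exact r.weylLH_mul_weylF)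
      (by rw [opLie_X]; exact r.weylLX_mul_weylF) (by rw [opLie_Y]; exact r.weylLY_mul_weylF))
    (fun j ψ hψ hf hj => eq_zero_of_mem_equivariantMaps hK hψ hf j hj) N _
    (restrictToCompact_mem_equivariantMaps hKU hinv) (LinearMap.ext hN) p hp hpφ
  ext f
  exact LinearMap.congr_fun h0 f

end Main

end SL2

end

theorem mainTheorem4
    {V : Type*} [NormedAddCommGroup V] [NormedSpace ℝ V] [FiniteDimensional ℝ V]
    [LieRingModule SL2.Alg V] [LieModule ℝ SL2.Alg V]
    (U : TopologicalSpace.Opens SL2.Alg) (hU : SL2.IsInvariantSet (U : Set SL2.Alg))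
    (φ : 𝓓'(U, V))
    (hinv : SL2.IsLocallyInvariant φ)
    (hvan : Distribution.IsVanishingOn φ ((U : Set SL2.Alg) \ SL2.nilpotentCone))
    (hfin : SL2.IsCasimirFinite φ) :
    φ = 0 := by
  ext f
  obtain ⟨K, hfK, hKU, hK⟩ :=
    SL2.exists_rot_invariant_compact hU f.hasCompactSupport.isCompact f.tsupport_subset
  have h := SL2.restrictToCompact_eq_zero hKU hK hinv hvan hfin
  -- The support of `f` lies in `K`, so `φ f` is a value of the restriction of `φ` to `K`.
  exact DFunLike.congr_fun h
    (ContDiffMapSupportedIn.of_support_subset f.contDiff ((subset_tsupport f).trans hfK))
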